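/- All manifolds are real, smooth and finite-dimensional. For a bivector $\Pi$ put $\Pi^\sharp\alpha=\Pi(\alpha,\cdot)$, i.e. $\langle\beta,\Pi^\sharp\alpha\rangle=\Pi(\alpha,\beta)$; for a $3$-form $\Phi$ put $\Phi^\sharp(X,Y)=\Phi(X,Y,\cdot)$; for an endomorphism $N$ put $[N,N](X,Y)=[NX,NY]-N[NX,Y]-N[X,NY]+N^2[X,Y]$ and $(i_N\Phi)(X,Y,Z)=\Phi(NX,Y,Z)+\Phi(X,NY,Z)+\Phi(X,Y,NZ)$, and let $N^t$ be the transpose of $N$. A *Poisson quasi-Nijenhuis (P-qN) structure* on a manifold $M$ is a triple $(\Pi,\Phi,N)$ of a smooth bivector field $\Pi$, a smooth closed $3$-form $\Phi$ and a smooth $(1,1)$-tensor field $N$ such that $[\Pi,\Pi]=0$ (Schouten–Nijenhuis bracket); $[N,N](X,Y)=\Pi^\sharp(\Phi^\sharp(X,Y))$ for all vector fields $X,Y$; $N\Pi^\sharp=\Pi^\sharp N^t$; $C(\Pi,N)=0$; and $d(i_N\Phi)=0$. Here, for $1$-forms $\alpha,\beta$, $$C(\Pi,N)(\alpha,\beta)=\{\alpha,\beta\}_{N\Pi}-\big(\{N^t\alpha,\beta\}_\Pi+\{\alpha,N^t\beta\}_\Pi-N^t\{\alpha,\beta\}_\Pi\big),$$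 $$\{\alpha,\beta\}_\Pi=\mathcal L_{\Pi^\sharp\alpha}\beta-\mathcal L_{\Pi^\sharp\beta}\alpha-d(\Pi(\alpha,\beta)),$$ and $\{\cdot,\cdot\}_{N\Pi}$ is defined by the same formula with $N\Pi^\sharp$ in place of $\Pi^\sharp$ and $\langle\beta,N\Pi^\sharp\alpha\rangle$ in place of $\Pi(\alpha,\beta)$. Let $G$ be a Lie group with identity $e$ and right translations $R_g(h)=hg$. Its Lie algebra is $T_eG$ with the bracket of right-invariant vector fields: $[v,w]$ is the value at $e$ of the Lie bracket of the right-invariant fields extending $v$ and $w$. For $r\in\Lambda^2T_eG$, $\phi\in\Lambda^3T_e^*G$, $n\in\operatorname{End}(T_eG)$ let $\overrightarrow r,\overrightarrow\phi,\overrightarrow n$ be the tensor fields obtained by right translation, $\overrightarrow r(g)=(T_eR_g)_*r$, $\overrightarrow\phi(g)=(T_gR_{g^{-1}})^*\phi$, $\overrightarrow n(g)=T_eR_g\circ n\circ T_gR_{g^{-1}}$. A P-qN structure on $G$ is *right-invariant* if it has the form $(\overrightarrow r,\overrightarrow\phi,\overrightarrow n)$. Let $\mathfrak g$ be a finite-dimensional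 real Lie algebra and $\mathcal L_X=\mathrm{ad}^*_X=-(\mathrm{ad}_X)^t$ on $\mathfrak g^*$. A triple $(r,\phi,n)$ with $r\in\Lambda^2\mathfrak g$, $\phi\in\Lambda^3\mathfrak g^*$, $n\in\operatorname{End}(\mathfrak g)$ is an *$r$-$qn$ structure* on $\mathfrak g$ if 1. $r$ solves the classical Yang–Baxter equation, i.e. its algebraic Schouten bracket with itself vanishes: $[r^\sharp\alpha,r^\sharp\beta]=r^\sharp(\mathrm{ad}^*_{r^\sharp\alpha}\beta-\mathrm{ad}^*_{r^\sharp\beta}\alpha)$ for all $\alpha,\beta\in\mathfrak g^*$; 2. $[n,n](X,Y)=r^\sharp(\phi^\sharp(X,Y))$ for all $X,Y\in\mathfrak g$; 3. $\phi$ and $i_n\phi$ are Chevalley–Eilenberg $3$-cocycles with values in the trivial module $\mathbb R$; 4. $n\circ r^\sharp=r^\sharp\circ n^t$; 5. $C(r,n)(\alpha,\beta):=\mathcal L_{r^\sharp\alpha}n^t\beta-\mathcal L_{r^\sharp\beta}n^t\alpha-n^t\mathcal L_{r^\sharp\alpha}\beta+n^t\mathcal L_{r^\sharp\beta}\alpha=0$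 for all $\alpha,\beta\in\mathfrak g^*$. **Proposition.** Let $(\Pi,\Phi,N)$ be a right-invariant P-qN structure on a Lie group $G$. Then its value $(\Pi_e,\Phi_e,N_e)$ at the identity is an $r$-$qn$ structure on the Lie algebra of $G$. Conversely, let $(r,\phi,n)$ be an $r$-$qn$ structure on a finite-dimensional real Lie algebra $\mathfrak g$, and let $G$ be a Lie group whose Lie algebra is identified with $\mathfrak g$ by a Lie algebra isomorphism. Then the right-invariant tensor fields $(\overrightarrow r,\overrightarrow\phi,\overrightarrow n)$ on $G$ form a right-invariant P-qN structure on $G$. -/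

import Mathlib

open scoped Manifold ContDiff

noncomputable section

/-! ### Linear algebra: bivectors and 3-forms on a real vector space -/

namespace PoissonQN

/-- A bivector on a real vector space `V`, viewed as an alternating bilinear form on the dual
space `V*`. For finite-dimensional `V` this is the same as an element of `Λ² V`. -/
@[ext]
structure Bivector (V : Type*) [AddCommGroup V] [Module ℝ V] where
  /-- The underlying bilinear form `(α, β) ↦ r(α, β)` on `V*`. -/
  form : Module.Dual ℝ V →ₗ[ℝ] Module.Dual ℝ V →ₗ[ℝ] ℝ
  /-- Skew-symmetry. -/
  alt : ∀ α, form α α = 0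

/-- A 3-form on a real vector space: an alternating trilinear map `V × V × V → ℝ`. -/
abbrev ThreeForm (V : Type*) [AddCommGroup V] [Module ℝ V] : Type _ := V [⋀^Fin 3]→ₗ[ℝ] ℝ

section LinearAlgebra

variable {V W : Type*} [AddCommGroup V] [Module ℝ V] [AddCommGroup W] [Module ℝ W]

/-- The map `r♯ : V* → V`, `r♯ α = ι_α r = r(α, ·)`, with `V** = V` (finite dimension). -/
def Bivector.sharp [FiniteDimensional ℝ V] (r : Bivector V) : Module.Dual ℝ V →ₗ[ℝ] V :=
  (Module.evalEquiv ℝ V).symm.toLinearMap ∘ₗ r.form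

/-- The defining property of `r♯`: `⟨β, r♯ α⟩ = r(α, β)`. -/
theorem Bivector.apply_sharp [FiniteDimensional ℝ V] (r : Bivector V) (α β : Module.Dual ℝ V) :
    β (r.sharp α) = r.form α β := by
  simp [Bivector.sharp]

/-- The image `T_* r` of a bivector under a linear map `T`:
`(T_* r)(α, β) = r(α ∘ T, β ∘ T)`. -/
def Bivector.map (T : V →ₗ[ℝ] W) (r : Bivector V) : Bivector W where
  form := r.form.compl₁₂ T.dualMap T.dualMap
  alt α := by simp [r.alt]

theorem ThreeForm.add₀ (φ : ThreeForm V) (X X' Y Z : V) :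
    φ ![X + X', Y, Z] = φ ![X, Y, Z] + φ ![X', Y, Z] := by
  have e : ∀ U : V, Function.update ![X, Y, Z] 0 U = ![U, Y, Z] := by
    intro U; ext i; fin_cases i <;> rfl
  simpa only [e] using φ.map_update_add ![X, Y, Z] 0 X X'

theorem ThreeForm.add₁ (φ : ThreeForm V) (X Y Y' Z : V) :
    φ ![X, Y + Y', Z] = φ ![X, Y, Z] + φ ![X, Y', Z] := by
  have e : ∀ U : V, Function.update ![X, Y, Z] 1 U = ![X, U, Z] := by
    intro U; ext i; fin_cases i <;> rfl
  simpa only [e] using φ.map_update_add ![X, Y, Z] 1 Y Y'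

theorem ThreeForm.add₂ (φ : ThreeForm V) (X Y Z Z' : V) :
    φ ![X, Y, Z + Z'] = φ ![X, Y, Z] + φ ![X, Y, Z'] := by
  have e : ∀ U : V, Function.update ![X, Y, Z] 2 U = ![X, Y, U] := by
    intro U; ext i; fin_cases i <;> rfl
  simpa only [e] using φ.map_update_add ![X, Y, Z] 2 Z Z'

theorem ThreeForm.smul₀ (φ : ThreeForm V) (c : ℝ) (X Y Z : V) :
    φ ![c • X, Y, Z] = c • φ ![X, Y, Z] := by
  have e : ∀ U : V, Function.update ![X, Y, Z] 0 U = ![U, Y, Z] := by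
    intro U; ext i; fin_cases i <;> rfl
  simpa only [e] using φ.map_update_smul ![X, Y, Z] 0 c X

theorem ThreeForm.smul₁ (φ : ThreeForm V) (c : ℝ) (X Y Z : V) :
    φ ![X, c • Y, Z] = c • φ ![X, Y, Z] := by
  have e : ∀ U : V, Function.update ![X, Y, Z] 1 U = ![X, U, Z] := by
    intro U; ext i; fin_cases i <;> rfl
  simpa only [e] using φ.map_update_smul ![X, Y, Z] 1 c Y

theorem ThreeForm.smul₂ (φ : ThreeForm V) (c : ℝ) (X Y Z : V) :
    φ ![X, Y, c • Z] = c • φ ![X, Y, Z] := by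
  have e : ∀ U : V, Function.update ![X, Y, Z] 2 U = ![X, Y, U] := by
    intro U; ext i; fin_cases i <;> rfl
  simpa only [e] using φ.map_update_smul ![X, Y, Z] 2 c Z

theorem ThreeForm.swap₀₁ (φ : ThreeForm V) (X Y Z : V) :
    φ ![X, Y, Z] = -φ ![Y, X, Z] := by
  have e : ![X, Y, Z] ∘ Equiv.swap (0 : Fin 3) 1 = ![Y, X, Z] := by
    ext i; fin_cases i <;> rfl
  have h := φ.map_swap ![X, Y, Z] (show (0 : Fin 3) ≠ 1 by decide)
  rw [e] at h
  rw [h, neg_neg]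

theorem ThreeForm.swap₀₂ (φ : ThreeForm V) (X Y Z : V) :
    φ ![X, Y, Z] = -φ ![Z, Y, X] := by
  have e : ![X, Y, Z] ∘ Equiv.swap (0 : Fin 3) 2 = ![Z, Y, X] := by
    ext i; fin_cases i <;> rfl
  have h := φ.map_swap ![X, Y, Z] (show (0 : Fin 3) ≠ 2 by decide)
  rw [e] at h
  rw [h, neg_neg]

theorem ThreeForm.swap₁₂ (φ : ThreeForm V) (X Y Z : V) :
    φ ![X, Y, Z] = -φ ![X, Z, Y] := by
  have e : ![X, Y, Z] ∘ Equiv.swap (1 : Fin 3) 2 = ![X, Z, Y] := by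
    ext i; fin_cases i <;> rfl
  have h := φ.map_swap ![X, Y, Z] (show (1 : Fin 3) ≠ 2 by decide)
  rw [e] at h
  rw [h, neg_neg]

/-- The map `φ♯ : V × V → V*`, `φ♯(X, Y) = ι_{X ∧ Y} φ = φ(X, Y, ·)`. -/
def ThreeForm.sharp (φ : ThreeForm V) (X Y : V) : Module.Dual ℝ V where
  toFun Z := φ ![X, Y, Z]
  map_add' Z Z' := φ.add₂ X Y Z Z'
  map_smul' c Z := φ.smul₂ c X Y Z

/-- The degree-zero derivation `i_n` on 3-forms:
`(i_n φ)(X, Y, Z) = φ(nX, Y, Z) + φ(X, nY, Z) + φ(X, Y, nZ)`. -/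
def ThreeForm.insert (n : V →ₗ[ℝ] V) (φ : ThreeForm V) : ThreeForm V where
  toFun v := φ ![n (v 0), v 1, v 2] + φ ![v 0, n (v 1), v 2] + φ ![v 0, v 1, n (v 2)]
  map_update_add' v i x y := by
    have h01 : (1 : Fin 3) ≠ 0 := Fin.ne_of_val_ne Nat.one_ne_zero
    have h02 : (2 : Fin 3) ≠ 0 := Fin.ne_of_val_ne (Nat.succ_ne_zero 1)
    have h12 : (2 : Fin 3) ≠ 1 := Fin.ne_of_val_ne (Nat.succ_ne_self 1)
    fin_cases i <;>
      simp [h01, h02, h12, h01.symm, h02.symm, h12.symm, add₀, add₁, add₂] <;> ring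
  map_update_smul' v i c x := by
    have h01 : (1 : Fin 3) ≠ 0 := Fin.ne_of_val_ne Nat.one_ne_zero
    have h02 : (2 : Fin 3) ≠ 0 := Fin.ne_of_val_ne (Nat.succ_ne_zero 1)
    have h12 : (2 : Fin 3) ≠ 1 := Fin.ne_of_val_ne (Nat.succ_ne_self 1)
    fin_cases i <;>
      simp [h01, h02, h12, h01.symm, h02.symm, h12.symm, smul₀, smul₁, smul₂] <;> ring
  map_eq_zero_of_eq' v i j h hij := by
    have z01 : ∀ a b : V, φ ![a, a, b] = 0 := fun a b ↦ by linarith [φ.swap₀₁ a a b]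
    have z02 : ∀ a b : V, φ ![a, b, a] = 0 := fun a b ↦ by linarith [φ.swap₀₂ a b a]
    have z12 : ∀ a b : V, φ ![b, a, a] = 0 := fun a b ↦ by linarith [φ.swap₁₂ b a a]
    fin_cases i <;> fin_cases j <;> simp at h hij <;> simp only [h, z01, z02, z12]
    · linarith [φ.swap₀₁ (n (v 1)) (v 1) (v 2)]
    · linarith [φ.swap₀₂ (n (v 2)) (v 1) (v 2)]
    · linarith [φ.swap₀₁ (n (v 0)) (v 0) (v 2)]
    · linarith [φ.swap₁₂ (v 0) (n (v 2)) (v 2)]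
    · linarith [φ.swap₀₂ (n (v 0)) (v 1) (v 0)]
    · linarith [φ.swap₁₂ (v 0) (n (v 1)) (v 1)]

end LinearAlgebra

/-! ### Structures on a Lie algebra -/

section LieAlgebra

variable {L : Type*} [LieRing L] [LieAlgebra ℝ L]

/-- The coadjoint action `ad*_X = -(ad_X)ᵗ : L* → L*`, also written `𝓛_X`. -/
def adStar (X : L) : Module.Dual ℝ L →ₗ[ℝ] Module.Dual ℝ L :=
  -(LieAlgebra.ad ℝ L X : L →ₗ[ℝ] L).dualMap

/-- The Chevalley–Eilenberg coboundary, with trivial coefficients `ℝ`, of a 3-cochain. -/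
def ceDiff (φ : ThreeForm L) (X₀ X₁ X₂ X₃ : L) : ℝ :=
  -φ ![⁅X₀, X₁⁆, X₂, X₃] + φ ![⁅X₀, X₂⁆, X₁, X₃] - φ ![⁅X₀, X₃⁆, X₁, X₂]
    - φ ![⁅X₁, X₂⁆, X₀, X₃] + φ ![⁅X₁, X₃⁆, X₀, X₂] - φ ![⁅X₂, X₃⁆, X₀, X₁]

/-- `φ` is a 3-cocycle with values in the trivial module `ℝ`. -/
def IsThreeCocycle (φ : ThreeForm L) : Prop :=
  ∀ X₀ X₁ X₂ X₃ : L, ceDiff φ X₀ X₁ X₂ X₃ = 0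

/-- The Nijenhuis torsion `[n, n](X, Y) = [nX, nY] - n[nX, Y] - n[X, nY] + n²[X, Y]`. -/
def algTorsion (n : L →ₗ[ℝ] L) (X Y : L) : L :=
  ⁅n X, n Y⁆ - n ⁅n X, Y⁆ - n ⁅X, n Y⁆ + n (n ⁅X, Y⁆)

variable [FiniteDimensional ℝ L]

/-- The bracket `[α, β]^r = ad*_{r♯ α} β - ad*_{r♯ β} α` on `L*` defined by a bivector `r`. -/
def sklyanin (r : Bivector L) (α β : Module.Dual ℝ L) : Module.Dual ℝ L :=
  adStar (r.sharp α) β - adStar (r.sharp β) α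

/-- The algebraic Schouten bracket `⟦r, r⟧ = -2 ⟨r, r⟩`, where
`⟨r, r⟩(α, β, γ) = ⟨γ, [r♯ α, r♯ β] - r♯ [α, β]^r⟩`. -/
def algSchouten (r : Bivector L) (α β γ : Module.Dual ℝ L) : ℝ :=
  -2 * γ (⁅r.sharp α, r.sharp β⁆ - r.sharp (sklyanin r α β))

/-- The classical Yang–Baxter equation `⟦r, r⟧ = 0`. -/
def IsCYBESolution (r : Bivector L) : Prop :=
  ∀ α β γ : Module.Dual ℝ L, algSchouten r α β γ = 0

/-- The concomitant
`C(r, n)(α, β) = 𝓛_{r♯α} nᵗβ - 𝓛_{r♯β} nᵗα - nᵗ 𝓛_{r♯α} β + nᵗ 𝓛_{r♯β} α`,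
with `𝓛_X = ad*_X`. -/
def algConcomitant (r : Bivector L) (n : L →ₗ[ℝ] L) (α β : Module.Dual ℝ L) : Module.Dual ℝ L :=
  adStar (r.sharp α) (n.dualMap β) - adStar (r.sharp β) (n.dualMap α)
    - n.dualMap (adStar (r.sharp α) β) + n.dualMap (adStar (r.sharp β) α)

/-- An `r`-`qn` structure `(r, φ, n)` on a finite-dimensional real Lie algebra. -/
structure IsRqnStructure (r : Bivector L) (φ : ThreeForm L) (n : L →ₗ[ℝ] L) : Prop where
  cybe : IsCYBESolution r
  torsion : ∀ X Y : L, algTorsion n X Y = r.sharp (φ.sharp X Y)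
  cocycle : IsThreeCocycle φ
  cocycle_insert : IsThreeCocycle (φ.insert n)
  comm : n ∘ₗ r.sharp = r.sharp ∘ₗ n.dualMap
  concomitant : ∀ α β : Module.Dual ℝ L, algConcomitant r n α β = 0

end LieAlgebra

/-! ### Tensor calculus on a manifold

Tensor fields are families of tensors on the tangent spaces. Lie derivatives and exterior
derivatives of forms are described by their values on vector fields. Smoothness of a tensor field is
tested on globally defined smooth arguments; on a Hausdorff manifold of finite dimension (for
instance on any Lie group) this is the same as smoothness of its components in charts. -/

section Manifold

variable {E : Type*} [NormedAddCommGroup E] [NormedSpace ℝ E]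
  {H : Type*} [TopologicalSpace H] (I : ModelWithCorners ℝ E H)
  {M : Type*} [TopologicalSpace M] [ChartedSpace H M]

instance instFiniteDimensionalTangentSpace [FiniteDimensional ℝ E] (x : M) :
    FiniteDimensional ℝ (TangentSpace I x) :=
  inferInstanceAs (FiniteDimensional ℝ E)

variable (M) in
/-- Vector fields on `M` (not necessarily smooth). -/
abbrev VectorFields : Type _ := ∀ x : M, TangentSpace I x

variable (M) in
/-- 1-forms on `M` (not necessarily smooth). -/
abbrev OneForms : Type _ := ∀ x : M, Module.Dual ℝ (TangentSpace I x)

/-- The derivative `X(f) = df(X)` of a function along a vector field. -/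
def dirDeriv (X : VectorFields I M) (f : M → ℝ) (x : M) : ℝ :=
  (mfderiv I 𝓘(ℝ, ℝ) f x (X x) : ℝ)

/-- The Lie derivative of a 1-form, `(L_X α)(Y) = X(α(Y)) - α([X, Y])`. -/
def lieDerivOneForm (X : VectorFields I M) (α : OneForms I M) (Y : VectorFields I M) (x : M) : ℝ :=
  dirDeriv I X (fun y ↦ α y (Y y)) x - α x (VectorField.mlieBracket I X Y x)

/-- The exterior derivative of a 3-form evaluated on four vector fields. -/
def extDerivThreeForm (Φ : ∀ x : M, ThreeForm (TangentSpace I x))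
    (X₀ X₁ X₂ X₃ : VectorFields I M) (x : M) : ℝ :=
  dirDeriv I X₀ (fun y ↦ Φ y ![X₁ y, X₂ y, X₃ y]) x
    - dirDeriv I X₁ (fun y ↦ Φ y ![X₀ y, X₂ y, X₃ y]) x
    + dirDeriv I X₂ (fun y ↦ Φ y ![X₀ y, X₁ y, X₃ y]) x
    - dirDeriv I X₃ (fun y ↦ Φ y ![X₀ y, X₁ y, X₂ y]) x
    - Φ x ![VectorField.mlieBracket I X₀ X₁ x, X₂ x, X₃ x]
    + Φ x ![VectorField.mlieBracket I X₀ X₂ x, X₁ x, X₃ x]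
    - Φ x ![VectorField.mlieBracket I X₀ X₃ x, X₁ x, X₂ x]
    - Φ x ![VectorField.mlieBracket I X₁ X₂ x, X₀ x, X₃ x]
    + Φ x ![VectorField.mlieBracket I X₁ X₃ x, X₀ x, X₂ x]
    - Φ x ![VectorField.mlieBracket I X₂ X₃ x, X₀ x, X₁ x]

/-- The Nijenhuis torsion
`[N, N](X, Y) = [NX, NY] - N[NX, Y] - N[X, NY] + N²[X, Y]` of a (1,1)-tensor field. -/
def torsion (N : ∀ x : M, TangentSpace I x →ₗ[ℝ] TangentSpace I x)
    (X Y : VectorFields I M) (x : M) : TangentSpace I x :=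
  VectorField.mlieBracket I (fun y ↦ N y (X y)) (fun y ↦ N y (Y y)) x
    - N x (VectorField.mlieBracket I (fun y ↦ N y (X y)) Y x)
    - N x (VectorField.mlieBracket I X (fun y ↦ N y (Y y)) x)
    + N x (N x (VectorField.mlieBracket I X Y x))

/-- The bracket of 1-forms attached to a 2-contravariant tensor field, given through the map
`S : T*M → TM`, `⟨β, S α⟩ = S(α, β)`, and evaluated on a vector field `Y`:
`{α, β}_S = L_{Sα} β - L_{Sβ} α - d(S(α, β))`. -/
def koszulBracket (S : ∀ x : M, Module.Dual ℝ (TangentSpace I x) →ₗ[ℝ] TangentSpace I x)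
    (α β : OneForms I M) (Y : VectorFields I M) (x : M) : ℝ :=
  lieDerivOneForm I (fun y ↦ S y (α y)) β Y x - lieDerivOneForm I (fun y ↦ S y (β y)) α Y x
    - dirDeriv I Y (fun y ↦ β y (S y (α y))) x

section Smooth

variable [IsManifold I ∞ M]

/-- Smoothness of a vector field, as a section of the tangent bundle. -/
def IsSmoothVectorField (X : VectorFields I M) : Prop :=
  ContMDiff I I.tangent ∞ (fun x ↦ (⟨x, X x⟩ : TangentBundle I M))

/-- A 1-form is smooth iff its values on smooth vector fields are smooth functions. -/
def IsSmoothOneForm (α : OneForms I M) : Prop :=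
  ∀ X : VectorFields I M, IsSmoothVectorField I X → ContMDiff I 𝓘(ℝ, ℝ) ∞ (fun x ↦ α x (X x))

variable [FiniteDimensional ℝ E]

/-- The Schouten–Nijenhuis bracket of two bivector fields, evaluated on three 1-forms:
`[P, Q](α, β, γ) = ∑_cyc (⟨L_{P♯α} β, Q♯γ⟩ + ⟨L_{Q♯α} β, P♯γ⟩)`, up to the overall sign on which
authors differ. On exact forms, with `{f, g}_P = P(df, dg)`, it is
`∑_cyc ({h, {f, g}_P}_Q + {h, {f, g}_Q}_P)`; so `[P, P]` is twice the Jacobiator of `{·, ·}_P`. -/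
def schoutenBracket (P Q : ∀ x : M, Bivector (TangentSpace I x)) (α β γ : OneForms I M)
    (x : M) : ℝ :=
  let T (a b c : OneForms I M) : ℝ :=
    lieDerivOneForm I (fun y ↦ (P y).sharp (a y)) b (fun y ↦ (Q y).sharp (c y)) x
      + lieDerivOneForm I (fun y ↦ (Q y).sharp (a y)) b (fun y ↦ (P y).sharp (c y)) x
  T α β γ + T β γ α + T γ α β

/-- The concomitant `C(P, N)(α, β) = {α, β}_{NP} - {α, β}_P^{Nᵗ}`, where
`{α, β}_P^{Nᵗ} = {Nᵗα, β}_P + {α, Nᵗβ}_P - Nᵗ{α, β}_P`, evaluated on a vector field `Y`. -/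
def concomitant (P : ∀ x : M, Bivector (TangentSpace I x))
    (N : ∀ x : M, TangentSpace I x →ₗ[ℝ] TangentSpace I x)
    (α β : OneForms I M) (Y : VectorFields I M) (x : M) : ℝ :=
  koszulBracket I (fun y ↦ N y ∘ₗ (P y).sharp) α β Y x
    - (koszulBracket I (fun y ↦ (P y).sharp) (fun y ↦ (N y).dualMap (α y)) β Y x
      + koszulBracket I (fun y ↦ (P y).sharp) α (fun y ↦ (N y).dualMap (β y)) Y x
      - koszulBracket I (fun y ↦ (P y).sharp) α β (fun y ↦ N y (Y y)) x)

/-- `(P, Φ, N)` is a Poisson quasi-Nijenhuis structure on `M`: a smooth bivector field `P`, a smooth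
3-form `Φ` and a smooth (1,1)-tensor field `N` (smoothness is tested on smooth arguments) subject to
the conditions below. -/
structure IsPqNStructure (P : ∀ x : M, Bivector (TangentSpace I x))
    (Φ : ∀ x : M, ThreeForm (TangentSpace I x))
    (N : ∀ x : M, TangentSpace I x →ₗ[ℝ] TangentSpace I x) : Prop where
  smooth_bivector : ∀ α β : OneForms I M, IsSmoothOneForm I α → IsSmoothOneForm I β →
    ContMDiff I 𝓘(ℝ, ℝ) ∞ (fun x ↦ (P x).form (α x) (β x))
  smooth_form : ∀ X Y Z : VectorFields I M, IsSmoothVectorField I X → IsSmoothVectorField I Y →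
    IsSmoothVectorField I Z → ContMDiff I 𝓘(ℝ, ℝ) ∞ (fun x ↦ Φ x ![X x, Y x, Z x])
  smooth_endo : ∀ X : VectorFields I M, IsSmoothVectorField I X →
    IsSmoothVectorField I (fun x ↦ N x (X x))
  /-- `Φ` is closed. -/
  closed : ∀ X₀ X₁ X₂ X₃ : VectorFields I M, IsSmoothVectorField I X₀ → IsSmoothVectorField I X₁ →
    IsSmoothVectorField I X₂ → IsSmoothVectorField I X₃ →
    ∀ x, extDerivThreeForm I Φ X₀ X₁ X₂ X₃ x = 0
  /-- `P` is Poisson: `[P, P] = 0`. -/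
  poisson : ∀ α β γ : OneForms I M, IsSmoothOneForm I α → IsSmoothOneForm I β →
    IsSmoothOneForm I γ → ∀ x, schoutenBracket I P P α β γ x = 0
  /-- `[N, N](X, Y) = P♯(Φ♯(X, Y))`. -/
  torsion : ∀ X Y : VectorFields I M, IsSmoothVectorField I X → IsSmoothVectorField I Y →
    ∀ x, torsion I N X Y x = (P x).sharp ((Φ x).sharp (X x) (Y x))
  /-- `N P♯ = P♯ Nᵗ`. -/
  comm : ∀ x, N x ∘ₗ (P x).sharp = (P x).sharp ∘ₗ (N x).dualMap
  /-- `C(P, N) = 0`. -/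
  concomitant : ∀ α β : OneForms I M, ∀ Y : VectorFields I M, IsSmoothOneForm I α →
    IsSmoothOneForm I β → IsSmoothVectorField I Y → ∀ x, concomitant I P N α β Y x = 0
  /-- `d(i_N Φ) = 0`. -/
  closed_insert : ∀ X₀ X₁ X₂ X₃ : VectorFields I M, IsSmoothVectorField I X₀ →
    IsSmoothVectorField I X₁ → IsSmoothVectorField I X₂ → IsSmoothVectorField I X₃ →
    ∀ x, extDerivThreeForm I (fun y ↦ (Φ y).insert (N y)) X₀ X₁ X₂ X₃ x = 0

end Smooth

end Manifold

/-! ### Right-invariant objects on a Lie group -/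

section LieGroup

variable {E : Type*} [NormedAddCommGroup E] [NormedSpace ℝ E]
  {H : Type*} [TopologicalSpace H] (I : ModelWithCorners ℝ E H)
  (G : Type*) [TopologicalSpace G] [ChartedSpace H G] [Group G]

/-- The Lie algebra of a Lie group `G`, modelled on right-invariant vector fields: the tangent space
at the identity, with the bracket `[v, w]` given by the value at the identity of the Lie bracket of
the right-invariant vector fields extending `v` and `w`. -/
def RightLieAlgebra : Type _ := TangentSpace I (1 : G)

instance : AddCommGroup (RightLieAlgebra I G) :=
  inferInstanceAs (AddCommGroup (TangentSpace I (1 : G)))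

instance : Module ℝ (RightLieAlgebra I G) :=
  inferInstanceAs (Module ℝ (TangentSpace I (1 : G)))

instance [FiniteDimensional ℝ E] : FiniteDimensional ℝ (RightLieAlgebra I G) :=
  inferInstanceAs (FiniteDimensional ℝ E)

variable {G}

/-- The tangent map `T_e R_g : 𝔤 → T_g G` of the right translation `R_g h = h g`. -/
def rightPush (g : G) : RightLieAlgebra I G →ₗ[ℝ] TangentSpace I g :=
  (mfderiv I I (fun h : G ↦ h * g) (1 : G)).toLinearMap

/-- The tangent map `T_g R_{g⁻¹} : T_g G → 𝔤`. -/
def rightPull (g : G) : TangentSpace I g →ₗ[ℝ] RightLieAlgebra I G :=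
  (mfderiv I I (fun h : G ↦ h * g⁻¹) g).toLinearMap

/-- The right-invariant vector field `g ↦ (T_e R_g) v`. -/
def rightInvariantVectorField (v : RightLieAlgebra I G) : VectorFields I G :=
  fun g ↦ rightPush I g v

variable (G) in
instance : Bracket (RightLieAlgebra I G) (RightLieAlgebra I G) where
  bracket v w := VectorField.mlieBracket I (rightInvariantVectorField I v)
    (rightInvariantVectorField I w) (1 : G)

theorem rightInvariantVectorField_add (v w : RightLieAlgebra I G) :
    rightInvariantVectorField I (v + w) =
      rightInvariantVectorField I v + rightInvariantVectorField I w := by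
  ext g; exact map_add (rightPush I g) v w

theorem rightInvariantVectorField_smul (c : ℝ) (v : RightLieAlgebra I G) :
    rightInvariantVectorField I (c • v) = c • rightInvariantVectorField I v := by
  ext g; exact map_smul (rightPush I g) c v

section Instances

variable [LieGroup I ∞ G]

theorem mdiffAt_mul_right (g h : G) : MDifferentiableAt I I (fun x : G ↦ x * g) h :=
  (contMDiff_mul_right (I := I) (n := ∞) (a := g)).contMDiffAt.mdifferentiableAt (by simp)

theorem inverse_mfderiv_mul_right (g h : G) :
    (mfderiv I I (fun b : G ↦ b * g) h).inverse = mfderiv I I (fun b : G ↦ b * g⁻¹) (h * g) := by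
  have A : mfderiv I I ((fun x : G ↦ x * g⁻¹) ∘ (fun x : G ↦ x * g)) h =
      ContinuousLinearMap.id _ _ := by
    have : (fun x : G ↦ x * g⁻¹) ∘ (fun x : G ↦ x * g) = id := by ext x; simp
    rw [this, id_eq, mfderiv_id]
  rw [mfderiv_comp (I' := I) _ (mdiffAt_mul_right I _ _) (mdiffAt_mul_right I _ _)] at A
  have A' : mfderiv I I ((fun x : G ↦ x * g) ∘ (fun x : G ↦ x * g⁻¹)) (h * g) =
      ContinuousLinearMap.id _ _ := by
    have : (fun x : G ↦ x * g) ∘ (fun x : G ↦ x * g⁻¹) = id := by ext x; simp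
    rw [this, id_eq, mfderiv_id]
  rw [mfderiv_comp (I' := I) _ (mdiffAt_mul_right I _ _) (mdiffAt_mul_right I _ _),
    mul_inv_cancel_right h g] at A'
  exact ContinuousLinearMap.inverse_eq A' A

/-- Right-invariant vector fields are invariant under pullback by right translations. -/
theorem mpullback_rightInvariantVectorField (g : G) (v : RightLieAlgebra I G) :
    VectorField.mpullback I I (fun h : G ↦ h * g) (rightInvariantVectorField I v) =
      rightInvariantVectorField I v := by
  ext h
  have D : (fun x : G ↦ x * h) = (fun b : G ↦ b * g⁻¹) ∘ (fun x : G ↦ x * (h * g)) := by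
    ext x; simp [mul_assoc]
  change (mfderiv I I (fun b : G ↦ b * g) h).inverse
      (mfderiv I I (fun x : G ↦ x * (h * g)) (1 : G) v) = mfderiv I I (fun x : G ↦ x * h) (1 : G) v
  rw [inverse_mfderiv_mul_right, D,
    mfderiv_comp (I' := I) _ (mdiffAt_mul_right I _ _) (mdiffAt_mul_right I _ _)]
  have key : ∀ k : G, h * g = k → (mfderiv I I (fun b : G ↦ b * g⁻¹) (h * g) : E →L[ℝ] E) =
      mfderiv I I (fun b : G ↦ b * g⁻¹) k := by rintro k rfl; rfl
  exact congrArg (fun T : E →L[ℝ] E ↦ T (mfderiv I I (fun x : G ↦ x * (h * g)) (1 : G) v))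
    (key _ (one_mul _).symm)

theorem rightInvariantVectorField_eq_mpullback (g : G) (V : VectorFields I G) :
    rightInvariantVectorField I (V 1 : RightLieAlgebra I G) g =
      VectorField.mpullback I I (fun h : G ↦ h * g⁻¹) V g := by
  change mfderiv I I (fun x : G ↦ x * g) (1 : G) (V 1) =
    (mfderiv I I (fun b : G ↦ b * g⁻¹) g).inverse (V (g * g⁻¹))
  rw [inverse_mfderiv_mul_right]
  have key : ∀ k l : G, k = 1 → l = g → (mfderiv I I (fun x : G ↦ x * g) (1 : G) : E →L[ℝ] E)
      (V 1) = (mfderiv I I (fun x : G ↦ x * l) k : E →L[ℝ] E) (V k) := by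
    rintro k l rfl rfl; rfl
  exact key _ _ (mul_inv_cancel g) (inv_inv g)

/-- Right-invariant vector fields are smooth. -/
theorem isSmooth_rightInvariantVectorField (v : RightLieAlgebra I G) :
    IsSmoothVectorField I (rightInvariantVectorField I v) := by
  let fg : G → TangentBundle I G := fun g ↦ ⟨g, 0⟩
  have sfg : ContMDiff I I.tangent ∞ fg := Bundle.contMDiff_zeroSection _ _
  let fv : G → TangentBundle I G := fun _ ↦ ⟨1, v⟩
  have sfv : ContMDiff I I.tangent ∞ fv := contMDiff_const
  let F₁ : G → (TangentBundle I G × TangentBundle I G) := fun g ↦ (fv g, fg g)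
  have S₁ : ContMDiff I (I.tangent.prod I.tangent) ∞ F₁ := sfv.prodMk sfg
  let F₂ : (TangentBundle I G × TangentBundle I G) → TangentBundle (I.prod I) (G × G) :=
    (equivTangentBundleProd I G I G).symm
  have S₂ : ContMDiff (I.tangent.prod I.tangent) (I.prod I).tangent ∞ F₂ :=
    contMDiff_equivTangentBundleProd_symm
  let F₃ : TangentBundle (I.prod I) (G × G) → TangentBundle I G :=
    tangentMap (I.prod I) I (fun p : G × G ↦ p.1 * p.2)
  have S₃ : ContMDiff (I.prod I).tangent I.tangent ∞ F₃ :=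
    ContMDiff.contMDiff_tangentMap (contMDiff_mul I ∞) (m := ∞) (by simp)
  have S := (S₃.comp S₂).comp S₁
  unfold IsSmoothVectorField
  convert! S with g
  · simp [F₁, F₂, F₃, fg, fv]
  · simp only [Function.comp_apply, tangentMap, F₃, F₂, F₁, fg, fv]
    rw [mfderiv_prod_eq_add_apply ((contMDiff_mul I ∞).mdifferentiable (by simp) _)]
    change (mfderiv I I (fun h : G ↦ h * g) (1 : G) : E →L[ℝ] E) v =
      (mfderiv I I (fun h : G ↦ h * g) (1 : G) : E →L[ℝ] E) v +
        (mfderiv I I (fun h : G ↦ 1 * h) g : E →L[ℝ] E) 0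
    rw [map_zero, add_zero]

theorem mdiffAt_rightInvariantVectorField (v : RightLieAlgebra I G) (g : G) :
    MDifferentiableAt I I.tangent
      (fun x ↦ (⟨x, rightInvariantVectorField I v x⟩ : TangentBundle I G)) g :=
  (isSmooth_rightInvariantVectorField I v).mdifferentiable (by simp) g

theorem contMDiffAt_rightInvariantVectorField (v : RightLieAlgebra I G) (g : G) :
    ContMDiffAt I I.tangent (minSmoothness ℝ 2)
      (fun x ↦ (⟨x, rightInvariantVectorField I v x⟩ : TangentBundle I G)) g :=
  ((isSmooth_rightInvariantVectorField I v).of_le (by simpa using ENat.LEInfty.out)) g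

/-- The Lie bracket of right-invariant vector fields is right-invariant. -/
theorem rightInvariantVectorField_bracket [CompleteSpace E] (v w : RightLieAlgebra I G) :
    rightInvariantVectorField I ⁅v, w⁆ =
      VectorField.mlieBracket I (rightInvariantVectorField I v) (rightInvariantVectorField I w) := by
  ext g
  have h := rightInvariantVectorField_eq_mpullback I g
    (VectorField.mlieBracket I (rightInvariantVectorField I v) (rightInvariantVectorField I w))
  refine h.trans ?_
  have : IsManifold I (minSmoothness ℝ 3) G := by
    simp only [minSmoothness_of_isRCLikeNormedField]; infer_instance
  rw [VectorField.mpullback_mlieBracket (n := minSmoothness ℝ 3)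
    (mdiffAt_rightInvariantVectorField I _ _) (mdiffAt_rightInvariantVectorField I _ _)
    (((contMDiff_mul_right (I := I) (n := ∞) (a := g⁻¹)).of_le
      (by simpa using ENat.LEInfty.out)).contMDiffAt) (minSmoothness_monotone (by norm_cast)),
    mpullback_rightInvariantVectorField, mpullback_rightInvariantVectorField]

instance [FiniteDimensional ℝ E] : LieRing (RightLieAlgebra I G) where
  add_lie u v w := by
    change VectorField.mlieBracket I _ _ _ = VectorField.mlieBracket I _ _ _ +
      VectorField.mlieBracket I _ _ _
    rw [rightInvariantVectorField_add, VectorField.mlieBracket_add_left]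
    · rfl
    · exact mdiffAt_rightInvariantVectorField I _ _
    · exact mdiffAt_rightInvariantVectorField I _ _
  lie_add u v w := by
    change VectorField.mlieBracket I _ _ _ = VectorField.mlieBracket I _ _ _ +
      VectorField.mlieBracket I _ _ _
    rw [rightInvariantVectorField_add, VectorField.mlieBracket_add_right]
    · rfl
    · exact mdiffAt_rightInvariantVectorField I _ _
    · exact mdiffAt_rightInvariantVectorField I _ _
  lie_self v := by
    change VectorField.mlieBracket I _ _ _ = 0
    simp
  leibniz_lie u v w := by
    have : CompleteSpace E := FiniteDimensional.complete ℝ E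
    have : IsManifold I (minSmoothness ℝ 3) G := by
      simp only [minSmoothness_of_isRCLikeNormedField]; infer_instance
    change VectorField.mlieBracket I _ (rightInvariantVectorField I ⁅v, w⁆) _ =
      VectorField.mlieBracket I (rightInvariantVectorField I ⁅u, v⁆) _ _ +
      VectorField.mlieBracket I _ (rightInvariantVectorField I ⁅u, w⁆) _
    simp only [rightInvariantVectorField_bracket]
    exact VectorField.leibniz_identity_mlieBracket_apply
      (contMDiffAt_rightInvariantVectorField I _ _) (contMDiffAt_rightInvariantVectorField I _ _)
      (contMDiffAt_rightInvariantVectorField I _ _)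

instance [FiniteDimensional ℝ E] : LieAlgebra ℝ (RightLieAlgebra I G) where
  lie_smul c v w := by
    change VectorField.mlieBracket I _ _ _ = c • VectorField.mlieBracket I _ _ _
    rw [rightInvariantVectorField_smul, VectorField.mlieBracket_const_smul_right]
    exact mdiffAt_rightInvariantVectorField I _ _

end Instances

/-- The right-invariant bivector field `g ↦ (T_e R_g)_* r`. -/
def rightBivector (r : Bivector (RightLieAlgebra I G)) (g : G) : Bivector (TangentSpace I g) :=
  r.map (rightPush I g)

/-- The right-invariant 3-form `g ↦ (T_g R_{g⁻¹})^* φ`. -/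
def rightThreeForm (φ : ThreeForm (RightLieAlgebra I G)) (g : G) : ThreeForm (TangentSpace I g) :=
  φ.compLinearMap (rightPull I g)

/-- The right-invariant (1,1)-tensor field `g ↦ T_e R_g ∘ n ∘ T_g R_{g⁻¹}`. -/
def rightEndo (n : RightLieAlgebra I G →ₗ[ℝ] RightLieAlgebra I G) (g : G) :
    TangentSpace I g →ₗ[ℝ] TangentSpace I g :=
  rightPush I g ∘ₗ n ∘ₗ rightPull I g

/-- A right-invariant Poisson quasi-Nijenhuis structure on a Lie group: a Poisson quasi-Nijenhuis
structure whose three tensor fields are the right translates of tensors on the Lie algebra. -/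
structure IsRightInvariantPqNStructure [LieGroup I ∞ G] [FiniteDimensional ℝ E]
    (P : ∀ g : G, Bivector (TangentSpace I g)) (Φ : ∀ g : G, ThreeForm (TangentSpace I g))
    (N : ∀ g : G, TangentSpace I g →ₗ[ℝ] TangentSpace I g) : Prop where
  isPqN : IsPqNStructure I P Φ N
  bivector : ∃ r : Bivector (RightLieAlgebra I G), P = rightBivector I r
  threeForm : ∃ φ : ThreeForm (RightLieAlgebra I G), Φ = rightThreeForm I φ
  endo : ∃ n : RightLieAlgebra I G →ₗ[ℝ] RightLieAlgebra I G, N = rightEndo I n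

end LieGroup

end PoissonQN

end

open scoped Manifold ContDiff

noncomputable section

namespace PoissonQN

/-! ### Leibniz calculus for functions with values in finite-dimensional vector spaces -/

section Calculus

variable {E : Type*} [NormedAddCommGroup E] [NormedSpace ℝ E]
  {H : Type*} [TopologicalSpace H] (I : ModelWithCorners ℝ E H)
  {M : Type*} [TopologicalSpace M] [ChartedSpace H M]

/-! Right translation trivializes `TG` as `G × 𝔤`. Smooth vector fields become smooth functions `ξ :
G → 𝔤`, smooth 1-forms become smooth functions `a : G → 𝔤*`, and right-invariant tensors become
constant tensors on `𝔤` (`IsSmoothVectorField.exists_eq_rightField`,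
`IsSmoothOneForm.exists_eq_rightCoField`). In this picture the bracket of vector fields is `D_ξ η -
D_η ξ + [ξ, η]`, the last term being the pointwise bracket of `𝔤` (`mlieBracket_rightField`).

Substitute this into the torsion, the exterior derivative, the Schouten bracket and the concomitant.
The tensors have constant coefficients, so they commute with `D` up to the Leibniz rule, and every
term containing a derivative cancels. What is left at `g` is, up to sign, the algebraic expression
in the values at `g` (`torsion_rightEndo`, `extDerivThreeForm_rightThreeForm`,
`schoutenBracket_rightBivector`, `concomitant_rightBivector`). The concomitant needs `n r♯ = r♯ nᵗ`,
which is available in both directions.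

Hence the algebraic identities on `𝔤` imply the differential ones for all smooth arguments.
Conversely, testing on constant `ξ` and `a` at the identity recovers the algebraic identities. For
an abstract `𝔤`, the structure is first carried to the Lie algebra of `G` by the given isomorphism
(`IsRqnStructure.map`). -/

theorem dirDeriv_add (X : VectorFields I M) {f g : M → ℝ} {x : M}
    (hf : MDifferentiableAt I 𝓘(ℝ, ℝ) f x) (hg : MDifferentiableAt I 𝓘(ℝ, ℝ) g x) :
    dirDeriv I X (fun y ↦ f y + g y) x = dirDeriv I X f x + dirDeriv I X g x := by
  unfold dirDeriv
  exact DFunLike.congr_fun (mfderiv_add hf hg) (X x)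

theorem dirDeriv_mul (X : VectorFields I M) {f g : M → ℝ} {x : M}
    (hf : MDifferentiableAt I 𝓘(ℝ, ℝ) f x) (hg : MDifferentiableAt I 𝓘(ℝ, ℝ) g x) :
    dirDeriv I X (fun y ↦ f y * g y) x = dirDeriv I X f x * g x + f x * dirDeriv I X g x := by
  unfold dirDeriv
  have h := DFunLike.congr_fun (hf.hasMFDerivAt.mul hg.hasMFDerivAt).mfderiv (X x)
  refine h.trans ?_
  change f x * dirDeriv I X g x + g x * dirDeriv I X f x =
    dirDeriv I X f x * g x + f x * dirDeriv I X g x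
  ring

theorem dirDeriv_const (X : VectorFields I M) (c : ℝ) (x : M) :
    dirDeriv I X (fun _ ↦ c) x = 0 := by
  unfold dirDeriv
  rw [mfderiv_const]; rfl

/-- Differentiability of the sum is carried along because the induction step of the derivative
formula needs it. -/
theorem dirDeriv_sum {ι : Type*} (s : Finset ι) (X : VectorFields I M) {f : ι → M → ℝ} {x : M}
    (hf : ∀ i, MDifferentiableAt I 𝓘(ℝ, ℝ) (f i) x) :
    MDifferentiableAt I 𝓘(ℝ, ℝ) (fun y ↦ ∑ i ∈ s, f i y) x ∧
    dirDeriv I X (fun y ↦ ∑ i ∈ s, f i y) x = ∑ i ∈ s, dirDeriv I X (f i) x := by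
  classical
  induction s using Finset.induction_on with
  | empty => simpa using ⟨mdifferentiableAt_const, dirDeriv_const I X 0 x⟩
  | insert i s hi ih =>
    simp only [Finset.sum_insert hi]
    exact ⟨(hf i).add ih.1, by rw [dirDeriv_add I X (hf i) ih.1, ih.2]⟩

/-- A map into a finite-dimensional space is weakly smooth if its composition with every linear
form is smooth. -/
def WeaklySmooth {V : Type*} [AddCommGroup V] [Module ℝ V] (ξ : M → V) : Prop :=
  ∀ ℓ : Module.Dual ℝ V, ContMDiff I 𝓘(ℝ, ℝ) ∞ (fun x ↦ ℓ (ξ x))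

/-- The derivative along a vector field of a map into a finite-dimensional space. -/
def vecDeriv {V : Type*} [AddCommGroup V] [Module ℝ V] [FiniteDimensional ℝ V]
    (X : VectorFields I M) (ξ : M → V) (x : M) : V :=
  ∑ i, dirDeriv I X (fun y ↦ (Module.finBasis ℝ V).coord i (ξ y)) x • Module.finBasis ℝ V i

variable {I}
variable {U V W : Type*} [AddCommGroup U] [Module ℝ U] [AddCommGroup V] [Module ℝ V]
  [AddCommGroup W] [Module ℝ W]

theorem WeaklySmooth.mdifferentiableAt {ξ : M → V} (hξ : WeaklySmooth I ξ) (ℓ : Module.Dual ℝ V)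
    (x : M) : MDifferentiableAt I 𝓘(ℝ, ℝ) (fun y ↦ ℓ (ξ y)) x :=
  (hξ ℓ).mdifferentiable (by simp) x

theorem weaklySmooth_const (v : V) : WeaklySmooth I (fun _ : M ↦ v) :=
  fun _ ↦ contMDiff_const

theorem WeaklySmooth.map {ξ : M → V} (hξ : WeaklySmooth I ξ) (T : V →ₗ[ℝ] W) :
    WeaklySmooth I (fun x ↦ T (ξ x)) :=
  fun ℓ ↦ hξ (ℓ ∘ₗ T)

section

variable [FiniteDimensional ℝ V]

theorem eq_of_forall_dual_apply_eq {v w : V} (h : ∀ ℓ : Module.Dual ℝ V, ℓ v = ℓ w) : v = w :=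
  sub_eq_zero.1 <| (Module.forall_dual_apply_eq_zero_iff ℝ _).1 fun ℓ ↦ by simp [h ℓ]

/-- Expanding `ℓ` in coordinates leaves constant coefficients. This characterizes `vecDeriv` without
reference to the chosen basis, and later identities are checked against linear forms through it. -/
theorem apply_vecDeriv (X : VectorFields I M) {ξ : M → V} (hξ : WeaklySmooth I ξ)
    (ℓ : Module.Dual ℝ V) (x : M) :
    ℓ (vecDeriv I X ξ x) = dirDeriv I X (fun y ↦ ℓ (ξ y)) x := by
  have h : (fun y ↦ ℓ (ξ y)) = fun y ↦ ∑ i, ℓ (Module.finBasis ℝ V i) *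
      (Module.finBasis ℝ V).coord i (ξ y) := by
    ext y
    conv_lhs => rw [← (Module.finBasis ℝ V).sum_repr (ξ y), map_sum]
    exact Finset.sum_congr rfl fun i _ ↦ by simp [mul_comm]
  rw [h, (dirDeriv_sum I _ X (f := fun i y ↦ ℓ (Module.finBasis ℝ V i) *
    (Module.finBasis ℝ V).coord i (ξ y)) fun i ↦ mdifferentiableAt_const.mul
    (hξ.mdifferentiableAt _ x)).2, vecDeriv, map_sum]
  refine Finset.sum_congr rfl fun i _ ↦ ?_
  rw [dirDeriv_mul I X mdifferentiableAt_const (hξ.mdifferentiableAt _ x), dirDeriv_const]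
  simp [mul_comm]

theorem vecDeriv_map [FiniteDimensional ℝ W] (X : VectorFields I M) {ξ : M → V} (hξ : WeaklySmooth I ξ) (T : V →ₗ[ℝ] W)
    (x : M) : vecDeriv I X (fun y ↦ T (ξ y)) x = T (vecDeriv I X ξ x) := by
  refine eq_of_forall_dual_apply_eq fun ℓ ↦ ?_
  rw [apply_vecDeriv X (hξ.map T)]
  exact (apply_vecDeriv X hξ (ℓ ∘ₗ T) x).symm

/-- Expanding only the first argument turns a bilinear expression into a sum of products of scalar
functions, each a linear form of one argument, so the scalar product rule applies. -/
theorem bilin_eq_sum (B : V →ₗ[ℝ] W →ₗ[ℝ] ℝ) (v : V) (w : W) :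
    B v w = ∑ i, (Module.finBasis ℝ V).coord i v * B (Module.finBasis ℝ V i) w := by
  conv_lhs => rw [← (Module.finBasis ℝ V).sum_repr v, map_sum, LinearMap.sum_apply]
  exact Finset.sum_congr rfl fun i _ ↦ by simp

theorem WeaklySmooth.bilin {ξ : M → V} {η : M → W} (hξ : WeaklySmooth I ξ)
    (hη : WeaklySmooth I η) (B : V →ₗ[ℝ] W →ₗ[ℝ] ℝ) :
    ContMDiff I 𝓘(ℝ, ℝ) ∞ (fun x ↦ B (ξ x) (η x)) := by
  have h : (fun x ↦ B (ξ x) (η x)) = fun x ↦ ∑ i, (Module.finBasis ℝ V).coord i (ξ x) *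
      B (Module.finBasis ℝ V i) (η x) := funext fun x ↦ bilin_eq_sum B _ _
  rw [h]
  exact contMDiff_finsetSum fun i _ ↦ (hξ _).mul (hη (B _))

theorem dirDeriv_bilin [FiniteDimensional ℝ W] (X : VectorFields I M) {ξ : M → V} {η : M → W} (hξ : WeaklySmooth I ξ)
    (hη : WeaklySmooth I η) (B : V →ₗ[ℝ] W →ₗ[ℝ] ℝ) (x : M) :
    dirDeriv I X (fun y ↦ B (ξ y) (η y)) x =
      B (vecDeriv I X ξ x) (η x) + B (ξ x) (vecDeriv I X η x) := by
  have h : (fun x ↦ B (ξ x) (η x)) = fun x ↦ ∑ i, (Module.finBasis ℝ V).coord i (ξ x) *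
      B (Module.finBasis ℝ V i) (η x) := funext fun x ↦ bilin_eq_sum B _ _
  rw [h, bilin_eq_sum B (ξ x), bilin_eq_sum B (vecDeriv I X ξ x)]
  rw [(dirDeriv_sum I _ X (f := fun i y ↦ (Module.finBasis ℝ V).coord i (ξ y) *
      B (Module.finBasis ℝ V i) (η y)) fun i ↦ (hξ.mdifferentiableAt _ x).mul
    (hη.mdifferentiableAt (B _) x)).2, ← Finset.sum_add_distrib]
  refine Finset.sum_congr rfl fun i _ ↦ ?_
  rw [dirDeriv_mul I X (hξ.mdifferentiableAt _ x) (hη.mdifferentiableAt (B _) x),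
    apply_vecDeriv X hξ, apply_vecDeriv X hη]

theorem WeaklySmooth.bilin_vec {ξ : M → V} {η : M → W} (hξ : WeaklySmooth I ξ)
    (hη : WeaklySmooth I η) (B : V →ₗ[ℝ] W →ₗ[ℝ] U) :
    WeaklySmooth I (fun x ↦ B (ξ x) (η x)) :=
  fun ℓ ↦ hξ.bilin hη (B.compr₂ ℓ)

theorem vecDeriv_bilin [FiniteDimensional ℝ U] [FiniteDimensional ℝ W] (X : VectorFields I M) {ξ : M → V} {η : M → W} (hξ : WeaklySmooth I ξ)
    (hη : WeaklySmooth I η) (B : V →ₗ[ℝ] W →ₗ[ℝ] U) (x : M) :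
    vecDeriv I X (fun y ↦ B (ξ y) (η y)) x =
      B (vecDeriv I X ξ x) (η x) + B (ξ x) (vecDeriv I X η x) := by
  refine eq_of_forall_dual_apply_eq fun ℓ ↦ ?_
  rw [apply_vecDeriv X (hξ.bilin_vec hη B), map_add]
  exact dirDeriv_bilin X hξ hη (B.compr₂ ℓ) x

/-- The evaluation pairing, as a bilinear map on `V* × V`, is `LinearMap.id` on `V*`. -/
theorem WeaklySmooth.pairing {a : M → Module.Dual ℝ V} {η : M → V} (ha : WeaklySmooth I a)
    (hη : WeaklySmooth I η) : ContMDiff I 𝓘(ℝ, ℝ) ∞ (fun x ↦ a x (η x)) :=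
  ha.bilin hη LinearMap.id

theorem dirDeriv_pairing (X : VectorFields I M) {a : M → Module.Dual ℝ V} {η : M → V}
    (ha : WeaklySmooth I a) (hη : WeaklySmooth I η) (x : M) :
    dirDeriv I X (fun y ↦ a y (η y)) x = vecDeriv I X a x (η x) + a x (vecDeriv I X η x) :=
  dirDeriv_bilin X ha hη LinearMap.id x

/-- `φ♯` as a bilinear map. -/
def ThreeForm.sharpBilin (φ : ThreeForm V) : V →ₗ[ℝ] V →ₗ[ℝ] Module.Dual ℝ V :=
  LinearMap.mk₂ ℝ φ.sharp
    (fun X X' Y ↦ by ext Z; exact φ.add₀ X X' Y Z) (fun c X Y ↦ by ext Z; exact φ.smul₀ c X Y Z)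
    (fun X Y Y' ↦ by ext Z; exact φ.add₁ X Y Y' Z) (fun c X Y ↦ by ext Z; exact φ.smul₁ c X Y Z)

theorem WeaklySmooth.threeForm (φ : ThreeForm V) {ξ η ζ : M → V} (hξ : WeaklySmooth I ξ)
    (hη : WeaklySmooth I η) (hζ : WeaklySmooth I ζ) :
    ContMDiff I 𝓘(ℝ, ℝ) ∞ (fun x ↦ φ ![ξ x, η x, ζ x]) :=
  (hξ.bilin_vec hη φ.sharpBilin).pairing hζ

theorem dirDeriv_threeForm (X : VectorFields I M) (φ : ThreeForm V) {ξ η ζ : M → V}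
    (hξ : WeaklySmooth I ξ) (hη : WeaklySmooth I η) (hζ : WeaklySmooth I ζ) (x : M) :
    dirDeriv I X (fun y ↦ φ ![ξ y, η y, ζ y]) x = φ ![vecDeriv I X ξ x, η x, ζ x] +
      φ ![ξ x, vecDeriv I X η x, ζ x] + φ ![ξ x, η x, vecDeriv I X ζ x] := by
  have h := dirDeriv_pairing X (hξ.bilin_vec hη φ.sharpBilin) hζ x
  rw [vecDeriv_bilin X hξ hη] at h
  exact h

end

end Calculus

theorem lie_eq_sum_coord {L : Type*} [LieRing L] [LieAlgebra ℝ L] [FiniteDimensional ℝ L]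
    (u v : L) : ⁅u, v⁆ =
      ∑ i, (Module.finBasis ℝ L).coord i v • ⁅u, Module.finBasis ℝ L i⁆ := by
  conv_lhs => rw [← (Module.finBasis ℝ L).sum_repr v, lie_sum]
  exact Finset.sum_congr rfl fun i _ ↦ lie_smul _ _ _

/-! ### The right trivialization of the tangent bundle and the Lie bracket in it -/

section RightTrivialization

variable {E : Type*} [NormedAddCommGroup E] [NormedSpace ℝ E]
  {H : Type*} [TopologicalSpace H] (I : ModelWithCorners ℝ E H)
  {G : Type*} [TopologicalSpace G] [ChartedSpace H G] [Group G]

theorem rightPush_one : rightPush I (1 : G) = LinearMap.id := by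
  ext v
  have : (fun h : G ↦ h * 1) = id := by ext; simp
  change mfderiv I I (fun h : G ↦ h * 1) (1 : G) v = v
  rw [this, mfderiv_id]; rfl

/-- The vector field whose expression in the right trivialization is `ξ`. -/
def rightField (ξ : G → RightLieAlgebra I G) : VectorFields I G :=
  fun g ↦ rightPush I g (ξ g)

section Frame

variable {I} [FiniteDimensional ℝ E]

variable (I G) in
/-- The frame of right-invariant vector fields attached to a basis of the Lie algebra. -/
def rightFrame (i : Fin (Module.finrank ℝ (RightLieAlgebra I G))) : VectorFields I G :=
  rightInvariantVectorField I (Module.finBasis ℝ (RightLieAlgebra I G) i)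

theorem rightField_eq_sum (ξ : G → RightLieAlgebra I G) :
    rightField I ξ = fun g ↦ ∑ i, (Module.finBasis ℝ (RightLieAlgebra I G)).coord i (ξ g) •
      rightFrame I G i g := by
  ext g
  conv_lhs => rw [rightField, ← (Module.finBasis ℝ (RightLieAlgebra I G)).sum_repr (ξ g), map_sum]
  exact Finset.sum_congr rfl fun i _ ↦ map_smul _ _ _

theorem rightPush_vecDeriv (V : VectorFields I G) (ξ : G → RightLieAlgebra I G) (g : G) :
    rightPush I g (vecDeriv I V ξ g) = ∑ i,
      dirDeriv I V (fun y ↦ (Module.finBasis ℝ (RightLieAlgebra I G)).coord i (ξ y)) g •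
        rightFrame I G i g := by
  rw [vecDeriv, map_sum]
  exact Finset.sum_congr rfl fun i _ ↦ map_smul _ _ _

theorem dirDeriv_rightField (ξ : G → RightLieAlgebra I G) (f : G → ℝ) (g : G) :
    dirDeriv I (rightField I ξ) f g =
      ∑ i, (Module.finBasis ℝ (RightLieAlgebra I G)).coord i (ξ g) *
        dirDeriv I (rightFrame I G i) f g := by
  unfold dirDeriv
  rw [rightField_eq_sum]
  let T : TangentSpace I g →ₗ[ℝ] ℝ := (mfderiv I 𝓘(ℝ, ℝ) f g).toLinearMap
  refine (map_sum T _ _).trans (Finset.sum_congr rfl fun i _ ↦ map_smul T _ _)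

/-- The derivative is linear over functions in its direction; no smoothness of `ξ` or `η` is needed.
-/
theorem vecDeriv_rightField {W : Type*} [AddCommGroup W] [Module ℝ W] [FiniteDimensional ℝ W]
    (ξ : G → RightLieAlgebra I G) (η : G → W) (g : G) :
    vecDeriv I (rightField I ξ) η g =
      ∑ i, (Module.finBasis ℝ (RightLieAlgebra I G)).coord i (ξ g) •
        vecDeriv I (rightFrame I G i) η g := by
  simp only [vecDeriv, dirDeriv_rightField, Finset.sum_smul, Finset.smul_sum, mul_smul]
  exact Finset.sum_comm

end Frame

variable [LieGroup I ∞ G]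

theorem rightPull_rightPush (g : G) (v : RightLieAlgebra I G) :
    rightPull I g (rightPush I g v) = v := by
  have A : mfderiv I I ((fun x : G ↦ x * g⁻¹) ∘ (fun x : G ↦ x * g)) 1 =
      ContinuousLinearMap.id _ _ := by
    have : (fun x : G ↦ x * g⁻¹) ∘ (fun x : G ↦ x * g) = id := by ext x; simp
    rw [this, id_eq, mfderiv_id]
  rw [mfderiv_comp (I' := I) _ (mdiffAt_mul_right I _ _) (mdiffAt_mul_right I _ _)] at A
  -- The chain rule differentiates at `1 * g`, not at `g`. Regarding all derivatives as
  -- endomorphisms of `E` lets the base point be rewritten.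
  have key : ∀ k : G, k = g → (mfderiv I I (fun b : G ↦ b * g⁻¹) k : E →L[ℝ] E) =
      mfderiv I I (fun b : G ↦ b * g⁻¹) g := by rintro k rfl; rfl
  exact (congrArg (fun T : E →L[ℝ] E ↦ T (mfderiv I I (fun x : G ↦ x * g) (1 : G) v))
    (key _ (one_mul g)).symm).trans (congrArg (fun T : E →L[ℝ] E ↦ T v) A)

theorem rightPush_rightPull (g : G) (v : TangentSpace I g) :
    rightPush I g (rightPull I g v) = v := by
  have A : mfderiv I I ((fun x : G ↦ x * g) ∘ (fun x : G ↦ x * g⁻¹)) g =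
      ContinuousLinearMap.id _ _ := by
    have : (fun x : G ↦ x * g) ∘ (fun x : G ↦ x * g⁻¹) = id := by ext x; simp
    rw [this, id_eq, mfderiv_id]
  rw [mfderiv_comp (I' := I) _ (mdiffAt_mul_right I _ _) (mdiffAt_mul_right I _ _)] at A
  have key : ∀ k : G, k = 1 → (mfderiv I I (fun b : G ↦ b * g) k : E →L[ℝ] E) =
      mfderiv I I (fun b : G ↦ b * g) (1 : G) := by rintro k rfl; rfl
  exact (congrArg (fun T : E →L[ℝ] E ↦ T (mfderiv I I (fun x : G ↦ x * g⁻¹) g v))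
    (key _ (mul_inv_cancel g)).symm).trans (congrArg (fun T : E →L[ℝ] E ↦ T v) A)

theorem rightPull_one : rightPull I (1 : G) = LinearMap.id := by
  ext v
  have h := rightPull_rightPush I (1 : G) v
  rwa [rightPush_one] at h

/-- The 1-form whose expression in the right trivialization is `a`. -/
def rightCoField (a : G → Module.Dual ℝ (RightLieAlgebra I G)) : OneForms I G :=
  fun g ↦ a g ∘ₗ rightPull I g

theorem rightField_rightPull (X : VectorFields I G) :
    rightField I (fun g ↦ rightPull I g (X g)) = X :=
  funext fun g ↦ rightPush_rightPull I g (X g)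

theorem rightCoField_comp_rightPush (α : OneForms I G) :
    rightCoField I (fun g ↦ α g ∘ₗ rightPush I g) = α := by
  ext g v
  exact congrArg (α g) (rightPush_rightPull I g v)

@[simp]
theorem rightCoField_rightPush (a : G → Module.Dual ℝ (RightLieAlgebra I G)) (g : G)
    (v : RightLieAlgebra I G) : rightCoField I a g (rightPush I g v) = a g v :=
  congrArg (a g) (rightPull_rightPush I g v)

theorem rightCoField_rightField (a : G → Module.Dual ℝ (RightLieAlgebra I G))
    (ξ : G → RightLieAlgebra I G) (g : G) :
    rightCoField I a g (rightField I ξ g) = a g (ξ g) :=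
  rightCoField_rightPush I a g (ξ g)

variable {I}

/-- The expression of a smooth vector field in the right trivialization is smooth. -/
theorem IsSmoothVectorField.weaklySmooth_rightPull [FiniteDimensional ℝ E] {X : VectorFields I G}
    (hX : IsSmoothVectorField I X) : WeaklySmooth I (fun g ↦ rightPull I g (X g)) := by
  intro ℓ
  let f : G → TangentBundle I G := fun g ↦ ⟨g⁻¹, 0⟩
  have sf : ContMDiff I I.tangent ∞ f :=
    (Bundle.contMDiff_zeroSection ℝ (TangentSpace I)).comp (contMDiff_inv I ∞)
  have S : ContMDiff I I.tangent ∞ fun g ↦ tangentMap (I.prod I) I (fun p : G × G ↦ p.1 * p.2)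
      ((equivTangentBundleProd I G I G).symm (⟨g, X g⟩, f g)) :=
    ((ContMDiff.contMDiff_tangentMap (contMDiff_mul I ∞) (m := ∞) (by simp)).comp
      contMDiff_equivTangentBundleProd_symm).comp (hX.prodMk sf)
  have S' : ContMDiff I I.tangent ∞
      fun g ↦ (⟨1, rightPull I g (X g)⟩ : TangentBundle I G) := by
    -- The tangent map lands over `g * g⁻¹`, which must be identified with `1` in the total space.
    have aux : ∀ (k : G) (v w : E), k = 1 → v = w →
        (⟨1, v⟩ : TangentBundle I G) = ⟨k, w⟩ := by rintro _ _ _ rfl rfl; rfl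
    refine S.congr fun g ↦ aux (g * g⁻¹) _ _ (mul_inv_cancel g) ?_
    refine Eq.trans ?_ (mfderiv_prod_eq_add_apply (I := I) (I' := I) (I'' := I)
      (p := (g, g⁻¹)) (v := (show E × E from (X g, 0))) ((contMDiff_mul I ∞).mdifferentiable (by simp) _)).symm
    change (mfderiv I I (fun h : G ↦ h * g⁻¹) g : E →L[ℝ] E) (X g) =
      (mfderiv I I (fun h : G ↦ h * g⁻¹) g : E →L[ℝ] E) (X g) +
        (mfderiv I I (fun h : G ↦ g * h) g⁻¹ : E →L[ℝ] E) 0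
    rw [map_zero, add_zero]
  let u : G → E := fun g ↦ (rightPull I g (X g) : RightLieAlgebra I G)
  have S₂ : ContMDiff I 𝓘(ℝ, E) ∞ u := fun g₀ ↦ by
    -- Over the fixed base point `1`, the fibre coordinate in the trivialization centred at `1` is
    -- the vector itself, so smoothness in `TG` becomes smoothness in `E`.
    refine (Bundle.contMDiffAt_totalSpace.1 (S' g₀)).2.congr_of_eventuallyEq
      (Filter.Eventually.of_forall fun g ↦ ?_)
    exact ((tangentBundleCore I G).coordChange_self (achart H (1 : G)) 1
      (mem_chart_source H (1 : G)) _).symm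
  let ℓ' : E →ₗ[ℝ] ℝ := ℓ
  exact (LinearMap.toContinuousLinearMap ℓ').contMDiff.comp S₂

theorem IsSmoothVectorField.exists_eq_rightField [FiniteDimensional ℝ E] {X : VectorFields I G}
    (hX : IsSmoothVectorField I X) : ∃ ξ, WeaklySmooth I ξ ∧ X = rightField I ξ :=
  ⟨_, hX.weaklySmooth_rightPull, (rightField_rightPull I X).symm⟩

theorem IsSmoothOneForm.exists_eq_rightCoField [FiniteDimensional ℝ E] {α : OneForms I G}
    (hα : IsSmoothOneForm I α) : ∃ a, WeaklySmooth I a ∧ α = rightCoField I a := by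
  refine ⟨fun g ↦ α g ∘ₗ rightPush I g, fun ℓ ↦ ?_, (rightCoField_comp_rightPush I α).symm⟩
  -- A linear form on `𝔤*` is evaluation at some `v`; the component of `a` along it is `α` on the
  -- smooth right-invariant field of `v`.
  obtain ⟨v, rfl⟩ := (Module.evalEquiv ℝ (RightLieAlgebra I G)).surjective ℓ
  exact hα _ (isSmooth_rightInvariantVectorField I v)

theorem WeaklySmooth.isSmoothOneForm [FiniteDimensional ℝ E]
    {a : G → Module.Dual ℝ (RightLieAlgebra I G)} (ha : WeaklySmooth I a) :
    IsSmoothOneForm I (rightCoField I a) :=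
  fun _ hX ↦ ha.pairing hX.weaklySmooth_rightPull

section Frame

variable [FiniteDimensional ℝ E]

/-- A vector field whose expression in the right trivialization is smooth is smooth. -/
theorem WeaklySmooth.isSmoothVectorField {ξ : G → RightLieAlgebra I G} (hξ : WeaklySmooth I ξ) :
    IsSmoothVectorField I (rightField I ξ) := by
  rw [rightField_eq_sum]
  exact ContMDiff.sum_section fun i _ ↦
    (hξ _).smul_section (isSmooth_rightInvariantVectorField I _)

theorem mlieBracket_sum_smul_right {ι : Type*} (s : Finset ι) (V : VectorFields I G)
    {W : ι → VectorFields I G} {f : ι → G → ℝ} {x : G}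
    (hf : ∀ i, ContMDiff I 𝓘(ℝ, ℝ) ∞ (f i)) (hW : ∀ i, IsSmoothVectorField I (W i)) :
    VectorField.mlieBracket I V (fun y ↦ ∑ i ∈ s, f i y • W i y) x =
      ∑ i ∈ s, (dirDeriv I V (f i) x • W i x + f i x • VectorField.mlieBracket I V (W i) x) := by
  classical
  induction s using Finset.induction_on with
  | empty =>
    simp only [Finset.sum_empty]
    exact congrFun VectorField.mlieBracket_zero_right x
  | insert i s hi ih =>
    simp only [Finset.sum_insert hi]
    have h := VectorField.mlieBracket_add_right (V := V) (W := f i • W i)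
      (W₁ := fun y ↦ ∑ i ∈ s, f i y • W i y)
      (((hf i).smul_section (hW i)).mdifferentiable (by simp) x)
      ((ContMDiff.sum_section fun i _ ↦ (hf i).smul_section (hW i)).mdifferentiable (by simp) x)
    rw [ih] at h
    refine h.trans (congrArg (· + _) ?_)
    exact VectorField.mlieBracket_smul_right ((hf i).mdifferentiable (by simp) x)
      ((hW i).mdifferentiable (by simp) x)

theorem mlieBracket_rightField_right (V : VectorFields I G) {ξ : G → RightLieAlgebra I G}
    (hξ : WeaklySmooth I ξ) (g : G) :
    VectorField.mlieBracket I V (rightField I ξ) g = rightPush I g (vecDeriv I V ξ g) +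
      ∑ i, (Module.finBasis ℝ (RightLieAlgebra I G)).coord i (ξ g) •
        VectorField.mlieBracket I V (rightFrame I G i) g := by
  rw [rightField_eq_sum, mlieBracket_sum_smul_right _ V (W := rightFrame I G) (fun i ↦ hξ _)
    (fun i ↦ isSmooth_rightInvariantVectorField I _), Finset.sum_add_distrib, rightPush_vecDeriv]

theorem mlieBracket_rightFrame (i j : Fin (Module.finrank ℝ (RightLieAlgebra I G))) (g : G) :
    VectorField.mlieBracket I (rightFrame I G i) (rightFrame I G j) g =
      rightPush I g ⁅Module.finBasis ℝ (RightLieAlgebra I G) i,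
        Module.finBasis ℝ (RightLieAlgebra I G) j⁆ := by
  have : CompleteSpace E := FiniteDimensional.complete ℝ E
  exact (congrFun (rightInvariantVectorField_bracket I _ _) g).symm

/-- The Lie bracket of vector fields in the right trivialization. -/
theorem mlieBracket_rightField {ξ η : G → RightLieAlgebra I G} (hξ : WeaklySmooth I ξ)
    (hη : WeaklySmooth I η) (g : G) :
    VectorField.mlieBracket I (rightField I ξ) (rightField I η) g =
      rightPush I g (vecDeriv I (rightField I ξ) η g - vecDeriv I (rightField I η) ξ g +
        ⁅ξ g, η g⁆) := by
  -- Antisymmetry reduces the Leibniz rule in the left slot to the one in the right slot.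
  have key (j) : VectorField.mlieBracket I (rightField I ξ) (rightFrame I G j) g =
      rightPush I g (-vecDeriv I (rightFrame I G j) ξ g +
        ⁅ξ g, Module.finBasis ℝ (RightLieAlgebra I G) j⁆) := by
    rw [VectorField.mlieBracket_swap_apply, mlieBracket_rightField_right _ hξ]
    simp only [mlieBracket_rightFrame, ← map_smul, ← map_sum, ← map_add, ← map_neg]
    congr 1
    rw [neg_add, ← lie_eq_sum_coord, lie_skew]
  rw [mlieBracket_rightField_right _ hη]
  simp only [key, ← map_smul, ← map_sum, ← map_add]
  congr 1
  simp only [smul_add, smul_neg, Finset.sum_add_distrib, Finset.sum_neg_distrib,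
    ← lie_eq_sum_coord, ← vecDeriv_rightField]
  abel

end Frame

end RightTrivialization

/-! ### Identities for bivectors, 3-forms and the algebraic brackets -/

section LinearAlgebra

variable {V : Type*} [AddCommGroup V] [Module ℝ V]

theorem ThreeForm.sub₀ (φ : ThreeForm V) (X X' Y Z : V) :
    φ ![X - X', Y, Z] = φ ![X, Y, Z] - φ ![X', Y, Z] := by
  have h := φ.add₀ (X - X') X' Y Z
  rw [sub_add_cancel] at h
  linarith

theorem Bivector.apply_sharp_swap [FiniteDimensional ℝ V] (r : Bivector V)
    (α β : Module.Dual ℝ V) : β (r.sharp α) = -α (r.sharp β) := by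
  have h := r.alt (α + β)
  simp only [map_add, LinearMap.add_apply, r.alt] at h
  rw [r.apply_sharp, r.apply_sharp]
  linarith

theorem ThreeForm.compLinearMap_apply {W : Type*} [AddCommGroup W] [Module ℝ W]
    (φ : ThreeForm V) (T : W →ₗ[ℝ] V) (X Y Z : W) :
    φ.compLinearMap T ![X, Y, Z] = φ ![T X, T Y, T Z] := by
  rw [AlternatingMap.compLinearMap_apply]
  congr 1
  ext i
  fin_cases i <;> rfl

theorem ThreeForm.insert_apply (n : V →ₗ[ℝ] V) (φ : ThreeForm V) (X Y Z : V) :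
    φ.insert n ![X, Y, Z] = φ ![n X, Y, Z] + φ ![X, n Y, Z] + φ ![X, Y, n Z] := rfl

theorem Bivector.sharp_map {W : Type*} [AddCommGroup W] [Module ℝ W] [FiniteDimensional ℝ V]
    [FiniteDimensional ℝ W] (T : V →ₗ[ℝ] W) (r : Bivector V) (α : Module.Dual ℝ W) :
    (r.map T).sharp α = T (r.sharp (α ∘ₗ T)) :=
  eq_of_forall_dual_apply_eq fun β ↦ ((r.map T).apply_sharp α β).trans
    (r.apply_sharp (α ∘ₗ T) (β ∘ₗ T)).symm

end LinearAlgebra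

section LieAlgebra

variable {L : Type*} [LieRing L] [LieAlgebra ℝ L]

theorem adStar_apply (X Y : L) (a : Module.Dual ℝ L) : adStar X a Y = -a ⁅X, Y⁆ := rfl

variable [FiniteDimensional ℝ L]

/-- Skewness of `r` moves the outer `r♯` onto `γ`, removing the coadjoint action. The resulting form
contains only brackets of vectors `r♯ α`. -/
theorem algSchouten_eq (r : Bivector L) (α β γ : Module.Dual ℝ L) :
    algSchouten r α β γ = -2 * (γ ⁅r.sharp α, r.sharp β⁆ - β ⁅r.sharp α, r.sharp γ⁆ +
      α ⁅r.sharp β, r.sharp γ⁆) := by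
  rw [algSchouten, map_sub, r.apply_sharp_swap (sklyanin r α β) γ, sklyanin, LinearMap.sub_apply,
    adStar_apply, adStar_apply]
  ring

theorem algConcomitant_apply (r : Bivector L) (n : L →ₗ[ℝ] L) (α β : Module.Dual ℝ L) (Y : L) :
    algConcomitant r n α β Y = -β (n ⁅r.sharp α, Y⁆) + α (n ⁅r.sharp β, Y⁆) +
      β ⁅r.sharp α, n Y⁆ - α ⁅r.sharp β, n Y⁆ := by
  change -β (n ⁅r.sharp α, Y⁆) - -α (n ⁅r.sharp β, Y⁆) - -β ⁅r.sharp α, n Y⁆ +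
    -α ⁅r.sharp β, n Y⁆ = _
  ring

end LieAlgebra

/-! ### Right-invariant tensors: differential expressions reduce to algebraic ones -/

section RightInvariant

variable {E : Type*} [NormedAddCommGroup E] [NormedSpace ℝ E]
  {H : Type*} [TopologicalSpace H] {I : ModelWithCorners ℝ E H}
  {G : Type*} [TopologicalSpace G] [ChartedSpace H G] [Group G]

theorem rightBivector_one (r : Bivector (RightLieAlgebra I G)) :
    rightBivector I r (1 : G) = r := by
  rw [rightBivector, rightPush_one]
  rfl

section

variable {ξ η ζ θ : G → RightLieAlgebra I G}
  {a b c : G → Module.Dual ℝ (RightLieAlgebra I G)}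

variable [FiniteDimensional ℝ E]

/-- The differentiated argument is put in the first slot, where brackets sit in the exterior
derivative, so that the two kinds of terms can be matched. -/
theorem dirDeriv_threeForm_swap (X : VectorFields I G) (φ : ThreeForm (RightLieAlgebra I G))
    (hξ : WeaklySmooth I ξ) (hη : WeaklySmooth I η) (hζ : WeaklySmooth I ζ) (x : G) :
    dirDeriv I X (fun y ↦ φ ![ξ y, η y, ζ y]) x = φ ![vecDeriv I X ξ x, η x, ζ x] -
      φ ![vecDeriv I X η x, ξ x, ζ x] + φ ![vecDeriv I X ζ x, ξ x, η x] := by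
  rw [dirDeriv_threeForm X φ hξ hη hζ, φ.swap₀₁ (ξ x), φ.swap₁₂ (ξ x) (η x), φ.swap₀₁ (ξ x)]
  ring

end

variable [LieGroup I ∞ G]

theorem rightThreeForm_one (φ : ThreeForm (RightLieAlgebra I G)) :
    rightThreeForm I φ (1 : G) = φ := by
  rw [rightThreeForm, rightPull_one]
  rfl

theorem rightEndo_one (n : RightLieAlgebra I G →ₗ[ℝ] RightLieAlgebra I G) :
    rightEndo I n (1 : G) = n := by
  rw [rightEndo, rightPull_one, rightPush_one]
  rfl

theorem rightEndo_rightField (n : RightLieAlgebra I G →ₗ[ℝ] RightLieAlgebra I G)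
    (ξ : G → RightLieAlgebra I G) (g : G) :
    rightEndo I n g (rightField I ξ g) = rightField I (fun y ↦ n (ξ y)) g :=
  congrArg (fun v ↦ rightPush I g (n v)) (rightPull_rightPush I g (ξ g))

theorem rightEndo_dualMap_rightCoField (n : RightLieAlgebra I G →ₗ[ℝ] RightLieAlgebra I G)
    (a : G → Module.Dual ℝ (RightLieAlgebra I G)) (g : G) :
    (rightEndo I n g).dualMap (rightCoField I a g) =
      rightCoField I (fun y ↦ n.dualMap (a y)) g := by
  ext v
  exact congrArg (a g) (rightPull_rightPush I g _)

theorem rightCoField_comp_rightPush_apply (a : G → Module.Dual ℝ (RightLieAlgebra I G)) (g : G) :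
    rightCoField I a g ∘ₗ rightPush I g = a g := by
  ext v
  exact rightCoField_rightPush I a g v

theorem rightThreeForm_rightField (φ : ThreeForm (RightLieAlgebra I G))
    (ξ η ζ : G → RightLieAlgebra I G) (g : G) :
    rightThreeForm I φ g ![rightField I ξ g, rightField I η g, rightField I ζ g] =
      φ ![ξ g, η g, ζ g] := by
  rw [rightThreeForm, ThreeForm.compLinearMap_apply]
  simp only [rightField, rightPull_rightPush]

theorem rightThreeForm_rightPush (φ : ThreeForm (RightLieAlgebra I G))
    (u v w : RightLieAlgebra I G) (g : G) :
    rightThreeForm I φ g ![rightPush I g u, rightPush I g v, rightPush I g w] = φ ![u, v, w] :=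
  rightThreeForm_rightField φ (fun _ ↦ u) (fun _ ↦ v) (fun _ ↦ w) g

/-- Thus closedness of `i_N Φ` is closedness of a right-invariant form, governed by the cocycle
`φ.insert n`. -/
theorem insert_rightThreeForm (n : RightLieAlgebra I G →ₗ[ℝ] RightLieAlgebra I G)
    (φ : ThreeForm (RightLieAlgebra I G)) (g : G) :
    (rightThreeForm I φ g).insert (rightEndo I n g) = rightThreeForm I (φ.insert n) g := by
  ext v
  have hv : v = ![v 0, v 1, v 2] := by ext i; fin_cases i <;> rfl
  rw [hv]
  obtain ⟨x, hx⟩ : ∃ x, v 0 = rightPush I g x := ⟨_, (rightPush_rightPull I g _).symm⟩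
  obtain ⟨y, hy⟩ : ∃ x, v 1 = rightPush I g x := ⟨_, (rightPush_rightPull I g _).symm⟩
  obtain ⟨z, hz⟩ : ∃ x, v 2 = rightPush I g x := ⟨_, (rightPush_rightPull I g _).symm⟩
  have hn (u) : rightEndo I n g (rightPush I g u) = rightPush I g (n u) :=
    rightEndo_rightField n (fun _ ↦ u) g
  rw [hx, hy, hz, ThreeForm.insert_apply, rightThreeForm_rightPush, ThreeForm.insert_apply]
  simp only [hn, rightThreeForm_rightPush]

variable [FiniteDimensional ℝ E]

theorem rightBivector_sharp_rightCoField (r : Bivector (RightLieAlgebra I G))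
    (a : G → Module.Dual ℝ (RightLieAlgebra I G)) (g : G) :
    (rightBivector I r g).sharp (rightCoField I a g) =
      rightField I (fun y ↦ r.sharp (a y)) g := by
  rw [rightBivector, Bivector.sharp_map, rightCoField_comp_rightPush_apply]
  rfl

variable {ξ η ζ θ : G → RightLieAlgebra I G}
  {a b c : G → Module.Dual ℝ (RightLieAlgebra I G)}

theorem torsion_rightEndo (n : RightLieAlgebra I G →ₗ[ℝ] RightLieAlgebra I G)
    (hξ : WeaklySmooth I ξ) (hη : WeaklySmooth I η) (g : G) :
    torsion I (rightEndo I n) (rightField I ξ) (rightField I η) g =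
      rightPush I g (algTorsion n (ξ g) (η g)) := by
  have hn (u) : rightEndo I n g (rightPush I g u) = rightPush I g (n u) :=
    rightEndo_rightField n (fun _ ↦ u) g
  have e (ζ : G → RightLieAlgebra I G) : (fun y ↦ rightEndo I n y (rightField I ζ y)) =
      rightField I (fun y ↦ n (ζ y)) := funext fun y ↦ rightEndo_rightField n ζ y
  simp only [torsion, e]
  rw [mlieBracket_rightField hξ hη, mlieBracket_rightField (hξ.map n) hη,
    mlieBracket_rightField hξ (hη.map n), mlieBracket_rightField (hξ.map n) (hη.map n)]
  simp only [hn, ← map_sub, ← map_add, vecDeriv_map _ hξ, vecDeriv_map _ hη]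
  congr 1
  simp only [algTorsion, map_sub, map_add]
  abel

theorem extDerivThreeForm_rightThreeForm (φ : ThreeForm (RightLieAlgebra I G))
    (hξ : WeaklySmooth I ξ) (hη : WeaklySmooth I η) (hζ : WeaklySmooth I ζ)
    (hθ : WeaklySmooth I θ) (g : G) :
    extDerivThreeForm I (rightThreeForm I φ) (rightField I ξ) (rightField I η) (rightField I ζ)
      (rightField I θ) g = ceDiff φ (ξ g) (η g) (ζ g) (θ g) := by
  have e (u v w) (g : G) : rightThreeForm I φ g ![rightPush I g u, rightField I v g,
      rightField I w g] = φ ![u, v g, w g] := rightThreeForm_rightPush φ u (v g) (w g) g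
  simp only [extDerivThreeForm, rightThreeForm_rightField]
  rw [mlieBracket_rightField hξ hη, mlieBracket_rightField hξ hζ, mlieBracket_rightField hξ hθ,
    mlieBracket_rightField hη hζ, mlieBracket_rightField hη hθ, mlieBracket_rightField hζ hθ,
    dirDeriv_threeForm_swap _ φ hη hζ hθ, dirDeriv_threeForm_swap _ φ hξ hζ hθ,
    dirDeriv_threeForm_swap _ φ hξ hη hθ, dirDeriv_threeForm_swap _ φ hξ hη hζ]
  simp only [e, ThreeForm.add₀, ThreeForm.sub₀, ceDiff]
  ring

theorem lieDerivOneForm_rightCoField (hξ : WeaklySmooth I ξ) (ha : WeaklySmooth I a)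
    (hη : WeaklySmooth I η) (g : G) :
    lieDerivOneForm I (rightField I ξ) (rightCoField I a) (rightField I η) g =
      vecDeriv I (rightField I ξ) a g (η g) + a g (vecDeriv I (rightField I η) ξ g) -
        a g ⁅ξ g, η g⁆ := by
  simp only [lieDerivOneForm, rightCoField_rightField]
  rw [mlieBracket_rightField hξ hη, rightCoField_rightPush, dirDeriv_pairing _ ha hη]
  simp only [map_add, map_sub]
  ring

/-- By skewness the term `b (r♯ D_{r♯c} a)` is `-(D_{r♯c} a) (r♯ b)`, which cancels a cyclic
permutation of `(D_{r♯a} b) (r♯ c)`. The factor 2 comes from taking both entries of the bracket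
equal. -/
theorem schoutenBracket_rightBivector (r : Bivector (RightLieAlgebra I G))
    (ha : WeaklySmooth I a) (hb : WeaklySmooth I b) (hc : WeaklySmooth I c) (g : G) :
    schoutenBracket I (rightBivector I r) (rightBivector I r) (rightCoField I a)
      (rightCoField I b) (rightCoField I c) g = -algSchouten r (a g) (b g) (c g) := by
  have e (a) : (fun y ↦ (rightBivector I r y).sharp (rightCoField I a y)) =
      rightField I (fun y ↦ r.sharp (a y)) :=
    funext fun y ↦ rightBivector_sharp_rightCoField r a y
  simp only [schoutenBracket, e]
  rw [lieDerivOneForm_rightCoField (ha.map r.sharp) hb (hc.map r.sharp),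
    lieDerivOneForm_rightCoField (hb.map r.sharp) hc (ha.map r.sharp),
    lieDerivOneForm_rightCoField (hc.map r.sharp) ha (hb.map r.sharp),
    vecDeriv_map _ ha, vecDeriv_map _ hb, vecDeriv_map _ hc, algSchouten_eq,
    r.apply_sharp_swap _ (a g), r.apply_sharp_swap _ (b g), r.apply_sharp_swap _ (c g),
    ← lie_skew (r.sharp (a g)) (r.sharp (b g)), ← lie_skew (r.sharp (a g)) (r.sharp (c g)),
    ← lie_skew (r.sharp (b g)) (r.sharp (c g))]
  simp only [map_neg]
  ring

/-- The differential of `S(α, β)` cancels the derivatives along `η` coming from the two Lie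
derivatives, by skewness of `s`. General `s` allows both `r♯` and `n r♯`. -/
theorem koszulBracket_of_skew
    {S : ∀ g : G, Module.Dual ℝ (TangentSpace I g) →ₗ[ℝ] TangentSpace I g}
    {s : Module.Dual ℝ (RightLieAlgebra I G) →ₗ[ℝ] RightLieAlgebra I G}
    (hS : ∀ a g, S g (rightCoField I a g) = rightField I (fun y ↦ s (a y)) g)
    (hs : ∀ α β : Module.Dual ℝ (RightLieAlgebra I G), β (s α) = -α (s β)) (ha : WeaklySmooth I a) (hb : WeaklySmooth I b)
    (hη : WeaklySmooth I η) (g : G) :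
    koszulBracket I S (rightCoField I a) (rightCoField I b) (rightField I η) g =
      vecDeriv I (rightField I fun y ↦ s (a y)) b g (η g) -
        vecDeriv I (rightField I fun y ↦ s (b y)) a g (η g) -
        b g ⁅s (a g), η g⁆ + a g ⁅s (b g), η g⁆ := by
  simp only [koszulBracket, hS, rightCoField_rightField]
  rw [lieDerivOneForm_rightCoField (ha.map s) hb hη, lieDerivOneForm_rightCoField (hb.map s) ha hη,
    dirDeriv_pairing _ hb (ha.map s), vecDeriv_map _ ha, vecDeriv_map _ hb,
    hs (vecDeriv I (rightField I η) b g) (a g)]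
  ring

theorem concomitant_rightBivector (r : Bivector (RightLieAlgebra I G))
    (n : RightLieAlgebra I G →ₗ[ℝ] RightLieAlgebra I G)
    (hrn : n ∘ₗ r.sharp = r.sharp ∘ₗ n.dualMap) (ha : WeaklySmooth I a) (hb : WeaklySmooth I b)
    (hη : WeaklySmooth I η) (g : G) :
    concomitant I (rightBivector I r) (rightEndo I n) (rightCoField I a) (rightCoField I b)
      (rightField I η) g = -algConcomitant r n (a g) (b g) (η g) := by
  have hc (α) : r.sharp (n.dualMap α) = n (r.sharp α) := (DFunLike.congr_fun hrn α).symm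
  have eN (ζ : G → RightLieAlgebra I G) : (fun y ↦ rightEndo I n y (rightField I ζ y)) =
      rightField I (fun y ↦ n (ζ y)) := funext fun y ↦ rightEndo_rightField n ζ y
  have eT (a : G → Module.Dual ℝ (RightLieAlgebra I G)) :
      (fun y ↦ (rightEndo I n y).dualMap (rightCoField I a y)) =
      rightCoField I (fun y ↦ n.dualMap (a y)) :=
    funext fun y ↦ rightEndo_dualMap_rightCoField n a y
  have hS₁ := rightBivector_sharp_rightCoField r
  have hS₂ (a) (g : G) : (rightEndo I n g ∘ₗ (rightBivector I r g).sharp) (rightCoField I a g) =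
      rightField I (fun y ↦ (n ∘ₗ r.sharp) (a y)) g := by
    rw [LinearMap.comp_apply, hS₁, rightEndo_rightField]
    rfl
  have hs₁ := r.apply_sharp_swap
  -- Skewness of `n r♯` is where commutation of `n` with `r♯` enters; it also cancels the remaining
  -- terms with `n r♯` inside a bracket at the end.
  have hs₂ (α β : Module.Dual ℝ (RightLieAlgebra I G)) :
      β ((n ∘ₗ r.sharp) α) = -α ((n ∘ₗ r.sharp) β) := by
    rw [LinearMap.comp_apply, LinearMap.comp_apply, ← hc β]
    exact hs₁ α (n.dualMap β)
  simp only [concomitant, eN, eT]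
  rw [koszulBracket_of_skew hS₂ hs₂ ha hb hη, koszulBracket_of_skew hS₁ hs₁ (ha.map _) hb hη,
    koszulBracket_of_skew hS₁ hs₁ ha (hb.map _) hη,
    koszulBracket_of_skew hS₁ hs₁ ha hb (hη.map n), vecDeriv_map _ ha, vecDeriv_map _ hb,
    algConcomitant_apply]
  simp only [hc, LinearMap.comp_apply, LinearMap.dualMap_apply]
  ring

theorem rightEndo_comp_sharp {r : Bivector (RightLieAlgebra I G)}
    {n : RightLieAlgebra I G →ₗ[ℝ] RightLieAlgebra I G}
    (hrn : n ∘ₗ r.sharp = r.sharp ∘ₗ n.dualMap) (g : G) :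
    rightEndo I n g ∘ₗ (rightBivector I r g).sharp =
      (rightBivector I r g).sharp ∘ₗ (rightEndo I n g).dualMap := by
  refine LinearMap.ext fun α ↦ ?_
  -- Every covector at `g` is the value there of a right-invariant 1-form.
  obtain ⟨a, rfl⟩ : ∃ a, α = rightCoField I (fun _ ↦ a) g :=
    ⟨α ∘ₗ rightPush I g, by ext v; exact congrArg α (rightPush_rightPull I g v).symm⟩
  rw [LinearMap.comp_apply, LinearMap.comp_apply, rightEndo_dualMap_rightCoField,
    rightBivector_sharp_rightCoField, rightBivector_sharp_rightCoField, rightEndo_rightField]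
  exact congrArg (rightPush I g) (DFunLike.congr_fun hrn a)

theorem rightBivector_sharp_rightThreeForm (r : Bivector (RightLieAlgebra I G))
    (φ : ThreeForm (RightLieAlgebra I G)) (ξ η : G → RightLieAlgebra I G) (g : G) :
    (rightBivector I r g).sharp
      ((rightThreeForm I φ g).sharp (rightField I ξ g) (rightField I η g)) =
      rightPush I g (r.sharp (φ.sharp (ξ g) (η g))) := by
  have h : (rightThreeForm I φ g).sharp (rightField I ξ g) (rightField I η g) =
      rightCoField I (fun _ ↦ φ.sharp (ξ g) (η g)) g := by
    ext v
    obtain ⟨x, rfl⟩ : ∃ x, v = rightPush I g x := ⟨_, (rightPush_rightPull I g _).symm⟩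
    rw [rightCoField_rightPush]
    exact rightThreeForm_rightPush φ _ _ x g
  rw [h, rightBivector_sharp_rightCoField]
  rfl

theorem IsRqnStructure.isPqNStructure {r : Bivector (RightLieAlgebra I G)}
    {φ : ThreeForm (RightLieAlgebra I G)}
    {n : RightLieAlgebra I G →ₗ[ℝ] RightLieAlgebra I G} (h : IsRqnStructure r φ n) :
    IsPqNStructure I (rightBivector I r) (rightThreeForm I φ) (rightEndo I n) where
  smooth_bivector α β hα hβ := by
    obtain ⟨a, ha, rfl⟩ := hα.exists_eq_rightCoField
    obtain ⟨b, hb, rfl⟩ := hβ.exists_eq_rightCoField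
    refine (ha.bilin hb r.form).congr fun g ↦ ?_
    rw [← Bivector.apply_sharp, rightBivector_sharp_rightCoField, rightCoField_rightField,
      r.apply_sharp]
  smooth_form X Y Z hX hY hZ := by
    obtain ⟨ξ, hξ, rfl⟩ := hX.exists_eq_rightField
    obtain ⟨η, hη, rfl⟩ := hY.exists_eq_rightField
    obtain ⟨ζ, hζ, rfl⟩ := hZ.exists_eq_rightField
    simp only [rightThreeForm_rightField]
    exact hξ.threeForm φ hη hζ
  smooth_endo X hX := by
    obtain ⟨ξ, hξ, rfl⟩ := hX.exists_eq_rightField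
    simp only [rightEndo_rightField]
    exact (hξ.map n).isSmoothVectorField
  closed X₀ X₁ X₂ X₃ h₀ h₁ h₂ h₃ g := by
    obtain ⟨ξ, hξ, rfl⟩ := h₀.exists_eq_rightField
    obtain ⟨η, hη, rfl⟩ := h₁.exists_eq_rightField
    obtain ⟨ζ, hζ, rfl⟩ := h₂.exists_eq_rightField
    obtain ⟨θ, hθ, rfl⟩ := h₃.exists_eq_rightField
    rw [extDerivThreeForm_rightThreeForm φ hξ hη hζ hθ, h.cocycle]
  poisson α β γ hα hβ hγ g := by
    obtain ⟨a, ha, rfl⟩ := hα.exists_eq_rightCoField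
    obtain ⟨b, hb, rfl⟩ := hβ.exists_eq_rightCoField
    obtain ⟨c, hc, rfl⟩ := hγ.exists_eq_rightCoField
    rw [schoutenBracket_rightBivector r ha hb hc, h.cybe, neg_zero]
  torsion X Y hX hY g := by
    obtain ⟨ξ, hξ, rfl⟩ := hX.exists_eq_rightField
    obtain ⟨η, hη, rfl⟩ := hY.exists_eq_rightField
    rw [torsion_rightEndo n hξ hη, h.torsion, rightBivector_sharp_rightThreeForm]
  comm := rightEndo_comp_sharp h.comm
  concomitant α β Y hα hβ hY g := by
    obtain ⟨a, ha, rfl⟩ := hα.exists_eq_rightCoField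
    obtain ⟨b, hb, rfl⟩ := hβ.exists_eq_rightCoField
    obtain ⟨η, hη, rfl⟩ := hY.exists_eq_rightField
    rw [concomitant_rightBivector r n h.comm ha hb hη, h.concomitant, LinearMap.zero_apply,
      neg_zero]
  closed_insert X₀ X₁ X₂ X₃ h₀ h₁ h₂ h₃ g := by
    obtain ⟨ξ, hξ, rfl⟩ := h₀.exists_eq_rightField
    obtain ⟨η, hη, rfl⟩ := h₁.exists_eq_rightField
    obtain ⟨ζ, hζ, rfl⟩ := h₂.exists_eq_rightField
    obtain ⟨θ, hθ, rfl⟩ := h₃.exists_eq_rightField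
    simp only [insert_rightThreeForm]
    rw [extDerivThreeForm_rightThreeForm _ hξ hη hζ hθ, h.cocycle_insert]

theorem IsPqNStructure.isRqnStructure {r : Bivector (RightLieAlgebra I G)}
    {φ : ThreeForm (RightLieAlgebra I G)}
    {n : RightLieAlgebra I G →ₗ[ℝ] RightLieAlgebra I G}
    (h : IsPqNStructure I (rightBivector I r) (rightThreeForm I φ) (rightEndo I n)) :
    IsRqnStructure r φ n := by
  have hV (v : RightLieAlgebra I G) : WeaklySmooth I (fun _ : G ↦ v) := weaklySmooth_const v
  have hF (a : Module.Dual ℝ (RightLieAlgebra I G)) : WeaklySmooth I (fun _ : G ↦ a) :=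
    weaklySmooth_const a
  -- Extracted first, since the reduction of the concomitant depends on it.
  have hcomm : n ∘ₗ r.sharp = r.sharp ∘ₗ n.dualMap := by
    have h₁ := h.comm 1
    rw [rightEndo_one, rightBivector_one] at h₁
    exact h₁
  refine ⟨fun α β γ ↦ ?_, fun X Y ↦ ?_, fun X₀ X₁ X₂ X₃ ↦ ?_, fun X₀ X₁ X₂ X₃ ↦ ?_, hcomm,
    fun α β ↦ LinearMap.ext fun Y ↦ ?_⟩
  · have := h.poisson _ _ _ (hF α).isSmoothOneForm (hF β).isSmoothOneForm
      (hF γ).isSmoothOneForm 1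
    rwa [schoutenBracket_rightBivector r (hF α) (hF β) (hF γ), neg_eq_zero] at this
  · have := h.torsion _ _ (hV X).isSmoothVectorField (hV Y).isSmoothVectorField 1
    rw [torsion_rightEndo n (hV X) (hV Y), rightBivector_sharp_rightThreeForm] at this
    simpa only [rightPull_rightPush] using congrArg (rightPull I (1 : G)) this
  · have := h.closed _ _ _ _ (hV X₀).isSmoothVectorField (hV X₁).isSmoothVectorField
      (hV X₂).isSmoothVectorField (hV X₃).isSmoothVectorField 1
    rwa [extDerivThreeForm_rightThreeForm φ (hV X₀) (hV X₁) (hV X₂) (hV X₃)] at this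
  · have := h.closed_insert _ _ _ _ (hV X₀).isSmoothVectorField (hV X₁).isSmoothVectorField
      (hV X₂).isSmoothVectorField (hV X₃).isSmoothVectorField 1
    simp only [insert_rightThreeForm] at this
    rwa [extDerivThreeForm_rightThreeForm _ (hV X₀) (hV X₁) (hV X₂) (hV X₃)] at this
  · have := h.concomitant _ _ _ (hF α).isSmoothOneForm (hF β).isSmoothOneForm
      (hV Y).isSmoothVectorField 1
    rwa [concomitant_rightBivector r n hcomm (hF α) (hF β) (hV Y), neg_eq_zero] at this

end RightInvariant

/-! ### Transport along a Lie algebra isomorphism -/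

section Transport

variable {L L' : Type*} [LieRing L] [LieAlgebra ℝ L] [FiniteDimensional ℝ L]
  [LieRing L'] [LieAlgebra ℝ L'] [FiniteDimensional ℝ L']

/-- Transport of an `r`-`qn` structure along an isomorphism of Lie algebras. -/
theorem IsRqnStructure.map {r : Bivector L} {φ : ThreeForm L} {n : L →ₗ[ℝ] L}
    (h : IsRqnStructure r φ n) (e : L ≃ₗ⁅ℝ⁆ L') :
    IsRqnStructure (r.map (e : L →ₗ[ℝ] L')) (φ.compLinearMap (e.symm : L' →ₗ[ℝ] L))
      ((e : L →ₗ[ℝ] L') ∘ₗ n ∘ₗ (e.symm : L' →ₗ[ℝ] L)) := by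
  have hr (α : Module.Dual ℝ L') : (r.map (e : L →ₗ[ℝ] L')).sharp α =
      e (r.sharp (α ∘ₗ (e : L →ₗ[ℝ] L'))) := Bivector.sharp_map _ r α
  have hn (X : L') : ((e : L →ₗ[ℝ] L') ∘ₗ n ∘ₗ (e.symm : L' →ₗ[ℝ] L)) X = e (n (e.symm X)) := rfl
  have hφ (X Y Z : L') : φ.compLinearMap (e.symm : L' →ₗ[ℝ] L) ![X, Y, Z] =
      φ ![e.symm X, e.symm Y, e.symm Z] := φ.compLinearMap_apply _ X Y Z
  -- Stated for arbitrary `ψ` so as to serve for both `φ` and `i_n φ`.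
  have hc (ψ : ThreeForm L) (hψ : IsThreeCocycle ψ) :
      IsThreeCocycle (ψ.compLinearMap (e.symm : L' →ₗ[ℝ] L)) := fun X₀ X₁ X₂ X₃ ↦ by
    have hψe (X Y Z : L') : ψ.compLinearMap (e.symm : L' →ₗ[ℝ] L) ![X, Y, Z] =
      ψ ![e.symm X, e.symm Y, e.symm Z] := ψ.compLinearMap_apply _ X Y Z
    have := hψ (e.symm X₀) (e.symm X₁) (e.symm X₂) (e.symm X₃)
    simpa only [ceDiff, hψe, LieEquiv.map_lie] using this
  refine ⟨fun α β γ ↦ ?_, fun X Y ↦ ?_, hc φ h.cocycle, ?_, ?_, fun α β ↦ ?_⟩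
  · have := h.cybe (α ∘ₗ (e : L →ₗ[ℝ] L')) (β ∘ₗ (e : L →ₗ[ℝ] L')) (γ ∘ₗ (e : L →ₗ[ℝ] L'))
    rw [algSchouten_eq] at this ⊢
    simp only [hr, ← LieEquiv.map_lie]
    exact this
  · have := congrArg e (h.torsion (e.symm X) (e.symm Y))
    rw [hr]
    have hs : ThreeForm.sharp (φ.compLinearMap (e.symm : L' →ₗ[ℝ] L)) X Y ∘ₗ (e : L →ₗ[ℝ] L') =
        φ.sharp (e.symm X) (e.symm Y) := by
      ext Z
      refine (hφ X Y (e Z)).trans ?_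
      rw [e.symm_apply_apply]
      rfl
    rw [hs, ← this]
    simp only [algTorsion, hn, map_add, map_sub, LieEquiv.map_lie, LieEquiv.symm_apply_apply]
  -- Inserting the conjugate of `n` into the pulled-back form gives the pull-back of `i_n φ`, since
  -- the inner `e.symm ∘ e` cancels.
  · convert hc _ h.cocycle_insert using 1
    ext v
    have hv : v = ![v 0, v 1, v 2] := by ext i; fin_cases i <;> rfl
    rw [hv]
    refine (ThreeForm.insert_apply _ _ _ _ _).trans ?_
    simp only [hφ, hn, LieEquiv.symm_apply_apply]
    exact ((φ.insert n).compLinearMap_apply _ _ _ _).symm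
  · refine LinearMap.ext fun α ↦ ?_
    have := congrArg e (DFunLike.congr_fun h.comm (α ∘ₗ (e : L →ₗ[ℝ] L')))
    rw [LinearMap.comp_apply, hr, hn, LieEquiv.symm_apply_apply]
    refine this.trans ((congrArg (fun β ↦ e (r.sharp β)) (LinearMap.ext fun X ↦ ?_)).trans
      (hr _).symm)
    change α (e (n X)) = α (e (n (e.symm (e X))))
    rw [e.symm_apply_apply]
  · ext Y
    have := DFunLike.congr_fun (h.concomitant (α ∘ₗ (e : L →ₗ[ℝ] L')) (β ∘ₗ (e : L →ₗ[ℝ] L')))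
      (e.symm Y)
    rw [algConcomitant_apply] at this ⊢
    simp only [hr, hn]
    have hl (X : L) : ⁅e X, Y⁆ = e ⁅X, e.symm Y⁆ := by
      rw [LieEquiv.map_lie, LieEquiv.apply_symm_apply]
    simp only [hl, ← LieEquiv.map_lie, LieEquiv.symm_apply_apply]
    exact this

end Transport

end PoissonQN

end

theorem proposition3p1
    {E : Type*} [NormedAddCommGroup E] [NormedSpace ℝ E] [FiniteDimensional ℝ E]
    {H : Type*} [TopologicalSpace H] (I : ModelWithCorners ℝ E H) [I.Boundaryless]
    (G : Type*) [TopologicalSpace G] [ChartedSpace H G] [Group G] [LieGroup I ∞ G] :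
    (∀ (P : ∀ g : G, PoissonQN.Bivector (TangentSpace I g))
        (Φ : ∀ g : G, PoissonQN.ThreeForm (TangentSpace I g))
        (N : ∀ g : G, TangentSpace I g →ₗ[ℝ] TangentSpace I g),
      PoissonQN.IsRightInvariantPqNStructure I P Φ N →
        PoissonQN.IsRqnStructure (L := PoissonQN.RightLieAlgebra I G) (P 1) (Φ 1) (N 1)) ∧
    (∀ (𝔤 : Type*) [LieRing 𝔤] [LieAlgebra ℝ 𝔤] [FiniteDimensional ℝ 𝔤]
        (r : PoissonQN.Bivector 𝔤) (φ : PoissonQN.ThreeForm 𝔤) (n : 𝔤 →ₗ[ℝ] 𝔤),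
      PoissonQN.IsRqnStructure r φ n →
      ∀ e : 𝔤 ≃ₗ⁅ℝ⁆ PoissonQN.RightLieAlgebra I G,
        PoissonQN.IsRightInvariantPqNStructure I
          (PoissonQN.rightBivector I (r.map (e : 𝔤 →ₗ[ℝ] PoissonQN.RightLieAlgebra I G)))
          (PoissonQN.rightThreeForm I
            (φ.compLinearMap (e.symm : PoissonQN.RightLieAlgebra I G →ₗ[ℝ] 𝔤)))
          (PoissonQN.rightEndo I
            ((e : 𝔤 →ₗ[ℝ] PoissonQN.RightLieAlgebra I G) ∘ₗ n ∘ₗ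
              (e.symm : PoissonQN.RightLieAlgebra I G →ₗ[ℝ] 𝔤)))) := by
  refine ⟨fun P Φ N h ↦ ?_, fun 𝔤 _ _ _ r φ n h e ↦
    ⟨(h.map e).isPqNStructure, ⟨_, rfl⟩, ⟨_, rfl⟩, ⟨_, rfl⟩⟩⟩
  -- The generating tensors are the values at the identity, where right translation is trivial.
  obtain ⟨hP, ⟨r, rfl⟩, ⟨φ, rfl⟩, ⟨n, rfl⟩⟩ := h
  rw [PoissonQN.rightBivector_one, PoissonQN.rightThreeForm_one, PoissonQN.rightEndo_one]
  exact hP.isRqnStructure
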